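/- Let $\mathfrak v=\mathbb R^m$ and $\mathfrak z=\mathbb R^r$ carry their standard inner products, let $n=m+r$, and let $j:\mathfrak z\ni Z\mapsto j_Z\in\mathfrak{so}(\mathfrak v)$ be linear. Let $\mathfrak g(j)=\mathfrak v\oplus\mathfrak z$ be the metric Lie algebra with the standard inner product in which $\mathfrak z$ is central, $[\mathfrak v,\mathfrak v]\subseteq\mathfrak z$ and $\langle j_ZX,Y\rangle=\langle Z,[X,Y]\rangle$ for $X,Y\in\mathfrak v$, $Z\in\mathfrak z$. Let $G(j)$ be the simply connected Lie group with Lie algebra $\mathfrak g(j)$ and $g(j)$ the left-invariant metric on $G(j)$ given by this inner product. Let $Z_1,\dots,Z_r$ be the standard orthonormal basis of $\mathfrak z$. A *curvature invariant* of $n$-dimensional Riemannian manifolds is a real polynomial $P$ in the components of the curvature tensor $R$ and its covariant derivatives $\nabla R,\nabla^2R,\dots$ with respect to an orthonormal basis of the tangent space, whose value, at each point of each $n$-dimensional Riemannian manifold, does not depend on the orthonormal basis chosen. It has *order* $k$ if each of its monomials $\prod_{i=1}^{\nu}(\nabla^{p_i}R)_{\cdots}$ satisfies $\sum_{i=1}^{\nu}(p_i+2)=k$.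 For $q\ge 1$, a tuple $(k_1,\dots,k_{2q})$ in $\{1,\dots,q\}^{2q}$ that contains each of $1,\dots,q$ exactly twice, and a division of it by bars into nonempty blocks of consecutive entries, put $$I_{k_1\ldots k_\lambda|\ldots|k_\mu\ldots k_{2q}}(j)=\sum_{\alpha_1,\dots,\alpha_q=1}^{r}\operatorname{Tr}\bigl(j_{Z_{\alpha_{k_1}}}\cdots j_{Z_{\alpha_{k_\lambda}}}\bigr)\cdots\operatorname{Tr}\bigl(j_{Z_{\alpha_{k_\mu}}}\cdots j_{Z_{\alpha_{k_{2q}}}}\bigr).$$ **Proposition.** Let $q\ge 1$ and let $P$ be a curvature invariant of order $2q$ of $n$-dimensional Riemannian manifolds. Then there are real coefficients $c_{k_1\ldots k_\lambda|\ldots|k_\mu\ldots k_{2q}}$, depending only on $P$, such that for all $m,r\ge 0$ with $m+r=n$, all linear maps $j:\mathbb R^r\to\mathfrak{so}(\mathbb R^m)$ and all points $x\in G(j)$, the value of $P$ on $(G(j),g(j))$ at $x$ equals $$\sum c_{k_1\ldots k_\lambda|\ldots|k_\mu\ldots k_{2q}}\;I_{k_1\ldots k_\lambda|\ldots|k_\mu\ldots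 k_{2q}}(j),$$ the sum being over all such tuples with bars. -/

import Mathlib

open scoped ContDiff RealInnerProductSpace Manifold

noncomputable section

/-! ### Riemannian metrics in a chart, the Levi-Civita connection and the curvature tensor -/

/-- A smooth Riemannian metric on a real vector space `E` (regarded as a manifold with one global
chart; the tangent space at every point is `E`). -/
structure SmoothMetric (E : Type*) [NormedAddCommGroup E] [NormedSpace ℝ E] where
  /-- the scalar product on the tangent space at a point -/
  val : E → E →L[ℝ] E →L[ℝ] ℝ
  smooth : ContDiff ℝ ∞ val
  symm : ∀ x u v, val x u v = val x v u
  pos : ∀ x u, u ≠ 0 → 0 < val x u u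

namespace SmoothMetric

variable {E : Type*} [NormedAddCommGroup E] [NormedSpace ℝ E] (g : SmoothMetric E)

/-- The Christoffel symbol of the first kind, as a covector:
`w ↦ ½ (∂_u g(v,w) + ∂_v g(u,w) - ∂_w g(u,v))`. -/
def christoffelFirst (x u v : E) : E →L[ℝ] ℝ :=
  (1 / 2 : ℝ) • (fderiv ℝ g.val x u v + fderiv ℝ g.val x v u
    - ((fderiv ℝ g.val x).flip u).flip v)

/-- The Christoffel symbol `Γ_x(u,v)`: the covector `christoffelFirst` with its index raised.
(In finite dimension `g.val x : E → E*` is invertible, see `christoffel_spec`.) -/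
def christoffel (x u v : E) : E :=
  (g.val x).inverse (g.christoffelFirst x u v)

/-- The Levi-Civita connection on vector fields: `(∇_X Y)(x) = (D_{X(x)} Y)(x) + Γ_x(X(x),Y(x))`. -/
def nabla (X Y : E → E) (x : E) : E :=
  fderiv ℝ Y x (X x) + g.christoffel x (X x) (Y x)

/-- The curvature endomorphism `R(u,v)w`, with the sign convention
`R(X,Y) = ∇_{[X,Y]} - [∇_X, ∇_Y]`. The tangent vectors are extended to constant (hence commuting)
vector fields. -/
def curvature (x u v w : E) : E :=
  g.nabla (fun _ => v) (g.nabla (fun _ => u) fun _ => w) x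
    - g.nabla (fun _ => u) (g.nabla (fun _ => v) fun _ => w) x

/-- The covariant derivative of a `(0,k)`-tensor field `T`, the direction of differentiation being
the first argument of `∇T`:
`(∇T)(a₀,a₁,…,a_k) = ∂_{a₀}(T(a₁,…,a_k)) - ∑ᵢ T(a₁,…,Γ(a₀,aᵢ),…,a_k)`. -/
def nablaTensor {k : ℕ} (T : E → (Fin k → E) → ℝ) (x : E) (a : Fin (k + 1) → E) : ℝ :=
  fderiv ℝ (fun y => T y (Fin.tail a)) x (a 0)
    - ∑ i : Fin k, T x (Function.update (Fin.tail a) i (g.christoffel x (a 0) (Fin.tail a i)))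

/-- The `p`-th covariant derivative `∇^p R` of the `(0,4)`-curvature tensor
`R(a₀,a₁,a₂,a₃) = ⟨R(a₀,a₁)a₂,a₃⟩`. -/
def nablaCurvature : (p : ℕ) → E → (Fin (4 + p) → E) → ℝ
  | 0 => fun x a => g.val x (g.curvature x (a 0) (a 1) (a 2)) (a 3)
  | p + 1 => g.nablaTensor (nablaCurvature p)

/-- `e` is an orthonormal basis of the tangent space at `x`. -/
def IsOrthonormalAt {n : ℕ} (x : E) (e : Module.Basis (Fin n) ℝ E) : Prop :=
  ∀ i k, g.val x (e i) (e k) = if i = k then 1 else 0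

theorem christoffel_spec [FiniteDimensional ℝ E] (x u v w : E) :
    g.val x (g.christoffel x u v) w =
      (1 / 2 : ℝ) * (fderiv ℝ g.val x u v w + fderiv ℝ g.val x v u w
        - fderiv ℝ g.val x w u v) := by
  have hinj : Function.Injective (g.val x) := by
    rw [injective_iff_map_eq_zero]
    intro a ha
    by_contra hne
    have := g.pos x a hne
    rw [ha] at this
    simp at this
  have hfin : Module.finrank ℝ E = Module.finrank ℝ (E →L[ℝ] ℝ) := by
    rw [← (LinearMap.toContinuousLinearMap (𝕜 := ℝ) (E := E) (F' := ℝ)).finrank_eq]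
    exact (Subspace.dual_finrank_eq (K := ℝ) (V := E)).symm
  have : FiniteDimensional ℝ (E →L[ℝ] ℝ) :=
    (LinearMap.toContinuousLinearMap (𝕜 := ℝ) (E := E) (F' := ℝ)).finiteDimensional
  let f : E ≃L[ℝ] (E →L[ℝ] ℝ) :=
    (LinearEquiv.ofInjectiveOfFinrankEq (g.val x).toLinearMap hinj hfin).toContinuousLinearEquiv
  have hf : g.val x = (f : E →L[ℝ] (E →L[ℝ] ℝ)) := by
    ext a b
    rfl
  have key : g.val x (g.christoffel x u v) = g.christoffelFirst x u v := by
    unfold christoffel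
    rw [hf, ContinuousLinearMap.inverse_equiv]
    exact f.apply_symm_apply _
  rw [key]
  simp [christoffelFirst]

end SmoothMetric

/-! ### Curvature invariants -/

/-- The formal variables for the components of the covariant derivatives of the curvature tensor
in dimension `n`: `⟨p, s⟩` stands for `(∇^p R)(e_{s 0}, …, e_{s (p+3)})`. -/
abbrev CurvatureVar (n : ℕ) : Type := Σ p : ℕ, (Fin (4 + p) → Fin n)

/-- The number of derivatives of the metric tensor involved in a component of `∇^p R`. -/
def CurvatureVar.order {n : ℕ} (s : CurvatureVar n) : ℕ := s.1 + 2

/-- The value of a polynomial in the components of `R, ∇R, ∇²R, …` at a point `x`, the components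
being taken with respect to the basis `e` of the tangent space at `x`. -/
def SmoothMetric.evalAt {E : Type*} [NormedAddCommGroup E] [NormedSpace ℝ E] (g : SmoothMetric E)
    {n : ℕ} (P : MvPolynomial (CurvatureVar n) ℝ) (x : E) (e : Module.Basis (Fin n) ℝ E) : ℝ :=
  MvPolynomial.eval (fun s : CurvatureVar n => g.nablaCurvature s.1 x fun i => e (s.2 i)) P

/-- A curvature invariant (of `n`-dimensional Riemannian manifolds): a polynomial in the components
of `R, ∇R, ∇²R, …` with respect to orthonormal bases whose value does not depend on the orthonormal
basis of the tangent space chosen. It is enough to consider metrics on `n`-dimensional vector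
spaces, because every germ of an `n`-dimensional Riemannian metric is the germ of such a metric. -/
def IsCurvatureInvariant {n : ℕ} (P : MvPolynomial (CurvatureVar n) ℝ) : Prop :=
  ∀ (E : Type) [NormedAddCommGroup E] [NormedSpace ℝ E] (g : SmoothMetric E) (x : E)
    (e e' : Module.Basis (Fin n) ℝ E), g.IsOrthonormalAt x e → g.IsOrthonormalAt x e' →
      g.evalAt P x e = g.evalAt P x e'

/-- `P` has order `k`: each of its terms involves a total of `k` derivatives of the metric. -/
def HasOrder {n : ℕ} (P : MvPolynomial (CurvatureVar n) ℝ) (k : ℕ) : Prop :=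
  MvPolynomial.IsWeightedHomogeneous CurvatureVar.order P k

/-! ### The two-step nilpotent Lie group `G(j)` and its left-invariant metric `g(j)` -/

/-- The space `𝔰𝔬(𝔳)` of skew-symmetric endomorphisms of `𝔳 = ℝ^m`. -/
abbrev SkewEnd (m : ℕ) : Submodule ℝ (Module.End ℝ (EuclideanSpace ℝ (Fin m))) :=
  LinearMap.skewAdjointSubmodule (innerₗ (EuclideanSpace ℝ (Fin m)))

/-- Linear maps `j : 𝔷 → 𝔰𝔬(𝔳)`, where `𝔷 = ℝ^r` and `𝔳 = ℝ^m`. -/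
abbrev JMap (m r : ℕ) : Type := EuclideanSpace ℝ (Fin r) →ₗ[ℝ] SkewEnd m

namespace JMap

variable {m r : ℕ} (j : JMap m r)

/-- The endomorphism `j_{Z_α}` of `𝔳`, for the standard orthonormal basis `Z_1, …, Z_r` of `𝔷`. -/
def basisEnd (α : Fin r) : Module.End ℝ (EuclideanSpace ℝ (Fin m)) :=
  (j (EuclideanSpace.single α 1) : Module.End ℝ (EuclideanSpace ℝ (Fin m)))

theorem skew (Z : EuclideanSpace ℝ (Fin r)) (X Y : EuclideanSpace ℝ (Fin m)) :
    ⟪(j Z : Module.End ℝ (EuclideanSpace ℝ (Fin m))) X, Y⟫ =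
      -⟪(j Z : Module.End ℝ (EuclideanSpace ℝ (Fin m))) Y, X⟫ := by
  have h : LinearMap.IsSkewAdjoint (innerₗ (EuclideanSpace ℝ (Fin m)))
      (j Z : Module.End ℝ (EuclideanSpace ℝ (Fin m))) :=
    (LinearMap.mem_skewAdjointSubmodule _).mp (j Z).2
  have h2 := h X Y
  simp only [innerₗ_apply_apply, Pi.neg_apply, inner_neg_right] at h2
  rw [h2, real_inner_comm]

/-- The `𝔷`-valued bracket on `𝔳`, characterised by `⟨j_Z X, Y⟩ = ⟨Z, [X,Y]⟩`
(see `inner_bracketV`). -/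
def bracketV : EuclideanSpace ℝ (Fin m) →ₗ[ℝ] EuclideanSpace ℝ (Fin m) →ₗ[ℝ]
    EuclideanSpace ℝ (Fin r) :=
  LinearMap.mk₂ ℝ (fun X Y => WithLp.toLp 2 fun α => ⟪j.basisEnd α X, Y⟫)
    (fun _ _ _ => by ext; simp [inner_add_left])
    (fun _ _ _ => by ext; simp [inner_smul_left])
    (fun _ _ _ => by ext; simp [inner_add_right])
    (fun _ _ _ => by ext; simp [inner_smul_right])

theorem inner_bracketV (Z : EuclideanSpace ℝ (Fin r)) (X Y : EuclideanSpace ℝ (Fin m)) :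
    ⟪(j Z : Module.End ℝ (EuclideanSpace ℝ (Fin m))) X, Y⟫ = ⟪Z, j.bracketV X Y⟫ := by
  have hZ : Z = ∑ α, Z α • EuclideanSpace.single α (1 : ℝ) := by
    ext β
    simp [Finset.sum_apply, Pi.single_apply]
  conv_lhs => rw [hZ]
  simp only [map_sum, map_smul, AddSubmonoidClass.coe_finsetSum, Submodule.coe_smul,
    LinearMap.sum_apply, LinearMap.smul_apply, sum_inner, inner_smul_left]
  simp [bracketV, PiLp.inner_apply, basisEnd, mul_comm]

theorem bracketV_swap (X Y : EuclideanSpace ℝ (Fin m)) :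
    j.bracketV X Y = -j.bracketV Y X := by
  ext α
  exact j.skew (EuclideanSpace.single α 1) X Y

theorem bracketV_self (X : EuclideanSpace ℝ (Fin m)) : j.bracketV X X = 0 := by
  ext α
  have h := j.skew (EuclideanSpace.single α 1) X X
  change ⟪(j (EuclideanSpace.single α 1) : Module.End ℝ (EuclideanSpace ℝ (Fin m))) X, X⟫ = 0
  linarith

/-- The underlying inner product space `𝔳 ⊕ 𝔷` of `𝔤(j)`, with the standard inner product. -/
abbrev Space (m r : ℕ) : Type := WithLp 2 (EuclideanSpace ℝ (Fin m) × EuclideanSpace ℝ (Fin r))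

/-- The Lie bracket of `𝔤(j)` on `𝔳 ⊕ 𝔷`: the summand `𝔷` is central and `[𝔳,𝔳] ⊆ 𝔷` is given by
`bracketV`. -/
def bracket : Space m r →ₗ[ℝ] Space m r →ₗ[ℝ] Space m r :=
  LinearMap.mk₂ ℝ (fun a b => WithLp.toLp 2 (0, j.bracketV a.fst b.fst))
    (fun _ _ _ => WithLp.ofLp_injective 2 (by simp))
    (fun _ _ _ => WithLp.ofLp_injective 2 (by simp))
    (fun _ _ _ => WithLp.ofLp_injective 2 (by simp))
    (fun _ _ _ => WithLp.ofLp_injective 2 (by simp))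

theorem bracket_apply (a b : Space m r) :
    j.bracket a b = WithLp.toLp 2 (0, j.bracketV a.fst b.fst) := rfl

theorem bracket_self (a : Space m r) : j.bracket a a = 0 := by
  rw [bracket_apply, bracketV_self]; rfl

theorem bracket_bracket_left (a b c : Space m r) : j.bracket (j.bracket a b) c = 0 := by
  have h : (j.bracket a b).fst = 0 := rfl
  rw [bracket_apply, h, map_zero]; rfl

theorem bracket_bracket_right (a b c : Space m r) : j.bracket a (j.bracket b c) = 0 := by
  have h : (j.bracket b c).fst = 0 := rfl
  rw [bracket_apply, h, map_zero]; rfl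

/-- The two-step nilpotent metric Lie algebra `𝔤(j)`. -/
def NilAlg (_j : JMap m r) : Type := Space m r

instance : NormedAddCommGroup j.NilAlg := inferInstanceAs (NormedAddCommGroup (Space m r))
instance : InnerProductSpace ℝ j.NilAlg := inferInstanceAs (InnerProductSpace ℝ (Space m r))
instance : FiniteDimensional ℝ j.NilAlg := inferInstanceAs (FiniteDimensional ℝ (Space m r))

instance : LieRing j.NilAlg where
  bracket a b := j.bracket a b
  add_lie a b c := LinearMap.map_add₂ j.bracket a b c
  lie_add a b c := map_add (j.bracket a) b c
  lie_self a := j.bracket_self a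
  leibniz_lie a b c := by
    have h : ∀ a b c : Space m r, j.bracket a (j.bracket b c) =
        j.bracket (j.bracket a b) c + j.bracket b (j.bracket a c) := fun a b c => by
      rw [bracket_bracket_right, bracket_bracket_right, bracket_bracket_left, add_zero]
    exact h a b c

instance : LieAlgebra ℝ j.NilAlg where
  lie_smul t a b := map_smul (j.bracket a) t b

/-- The simply connected Lie group `G(j)` with Lie algebra `𝔤(j)`. It is identified with `𝔤(j)` by
the Lie group exponential map, which is a global chart; the group law is then given by the
Campbell-Baker-Hausdorff formula `a * b = a + b + ½ [a, b]`. -/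
def NilGroup (j : JMap m r) : Type := j.NilAlg

instance : NormedAddCommGroup j.NilGroup := inferInstanceAs (NormedAddCommGroup j.NilAlg)
instance : InnerProductSpace ℝ j.NilGroup := inferInstanceAs (InnerProductSpace ℝ j.NilAlg)
instance : FiniteDimensional ℝ j.NilGroup := inferInstanceAs (FiniteDimensional ℝ j.NilAlg)

/-- The bracket of `𝔤(j)`, as a continuous bilinear map on the chart of `G(j)`. -/
def bracketL : j.NilGroup →L[ℝ] j.NilGroup →L[ℝ] j.NilGroup :=
  LinearMap.toContinuousBilinearMap (j.bracket : j.NilGroup →ₗ[ℝ] j.NilGroup →ₗ[ℝ] j.NilGroup)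

theorem bracketL_apply (a b : j.NilGroup) :
    j.bracketL a b = @Bracket.bracket j.NilAlg j.NilAlg _ a b := rfl

theorem bracketL_self (a : j.NilGroup) : j.bracketL a a = 0 := j.bracket_self a

theorem bracketL_left (a b c : j.NilGroup) : j.bracketL (j.bracketL a b) c = 0 :=
  j.bracket_bracket_left a b c

theorem bracketL_right (a b c : j.NilGroup) : j.bracketL a (j.bracketL b c) = 0 :=
  j.bracket_bracket_right a b c

instance : Mul j.NilGroup := ⟨fun a b => a + b + (1 / 2 : ℝ) • j.bracketL a b⟩
instance : One j.NilGroup := ⟨(0 : j.NilGroup)⟩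
instance : Inv j.NilGroup := ⟨fun a => -a⟩

theorem mul_def (a b : j.NilGroup) : a * b = a + b + (1 / 2 : ℝ) • j.bracketL a b := rfl
theorem one_def : (1 : j.NilGroup) = 0 := rfl
theorem inv_def (a : j.NilGroup) : a⁻¹ = -a := rfl

instance : Group j.NilGroup := Group.ofLeftAxioms
  (fun a b c => by
    simp only [mul_def, map_add, map_smul, add_apply,
      smul_apply, bracketL_left, bracketL_right, smul_zero, add_zero, smul_add]
    abel)
  (fun a => by simp [mul_def, one_def])
  (fun a => by simp [mul_def, one_def, inv_def, bracketL_self])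

instance : LieGroup 𝓘(ℝ, j.NilGroup) ∞ j.NilGroup where
  contMDiff_mul := by
    rw [← modelWithCornersSelf_prod, chartedSpaceSelf_prod]
    refine ContDiff.contMDiff ?_
    simp only [mul_def]
    exact (contDiff_fst.add contDiff_snd).add
      (((j.bracketL.contDiff.comp contDiff_fst).clm_apply contDiff_snd).const_smul (1 / 2 : ℝ))
  contMDiff_inv := by
    refine ContDiff.contMDiff ?_
    simp only [inv_def]
    exact contDiff_neg

/-- The Lie algebra of left-invariant vector fields of the Lie group `G(j)` is `𝔤(j)`. -/
theorem groupLieAlgebra_bracket (u v : GroupLieAlgebra 𝓘(ℝ, j.NilGroup) j.NilGroup) :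
    ⁅u, v⁆ = @Bracket.bracket j.NilAlg j.NilAlg _ u v := by
  have hinv : ∀ w : j.NilGroup, (mulInvariantVectorField (I := 𝓘(ℝ, j.NilGroup)) w :
      j.NilGroup → j.NilGroup) = fun a => w + (1 / 2 : ℝ) • j.bracketL a w := by
    intro w
    funext a
    have h : HasFDerivAt (fun b : j.NilGroup => a * b)
        (0 + ContinuousLinearMap.id ℝ j.NilGroup + (1 / 2 : ℝ) • j.bracketL a) 1 := by
      simp only [mul_def]
      exact ((hasFDerivAt_const a _).add (hasFDerivAt_id _)).add
        ((j.bracketL a).hasFDerivAt.const_smul (1 / 2 : ℝ))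
    unfold mulInvariantVectorField
    rw [mfderiv_eq_fderiv, h.fderiv, zero_add]
    rfl
  have hder : ∀ w : j.NilGroup, HasFDerivAt (fun a => w + (1 / 2 : ℝ) • j.bracketL a w)
      ((1 / 2 : ℝ) • j.bracketL.flip w) (1 : j.NilGroup) := fun w =>
    ((j.bracketL.flip w).hasFDerivAt.const_smul (1 / 2 : ℝ)).const_add w
  have hb : ∀ u v : j.NilGroup, VectorField.lieBracket ℝ
      (fun a : j.NilGroup => u + (1 / 2 : ℝ) • j.bracketL a u)
      (fun a : j.NilGroup => v + (1 / 2 : ℝ) • j.bracketL a v) 1 = j.bracketL u v := by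
    intro u v
    have hsw : j.bracketL v u = -j.bracketL u v := by
      have h := j.bracketL_self (u + v)
      simp only [map_add, add_apply, bracketL_self, zero_add, add_zero] at h
      exact eq_neg_of_add_eq_zero_left h
    rw [VectorField.lieBracket, (hder u).fderiv, (hder v).fderiv]
    simp only [one_def, map_zero, zero_apply, smul_zero, add_zero, smul_apply,
      ContinuousLinearMap.flip_apply]
    rw [hsw, smul_neg, sub_neg_eq_add, ← add_smul]
    norm_num
  rw [GroupLieAlgebra.bracket_def, ← VectorField.mlieBracketWithin_univ,
    VectorField.mlieBracketWithin_eq_lieBracketWithin]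
  refine Eq.trans ?_ (hb u v)
  refine (congrFun (VectorField.lieBracketWithin_univ (𝕜 := ℝ) (E := j.NilGroup)
    (V := mulInvariantVectorField (I := 𝓘(ℝ, j.NilGroup)) u)
    (W := mulInvariantVectorField (I := 𝓘(ℝ, j.NilGroup)) v)) (1 : j.NilGroup)).trans ?_
  exact congrArg₂ (fun V W => VectorField.lieBracket ℝ V W (1 : j.NilGroup)) (hinv u) (hinv v)

/-- The differential at `a` of the left translation by `a⁻¹`. -/
def leftDifferential (a : j.NilGroup) : j.NilGroup →L[ℝ] j.NilGroup :=
  fderiv ℝ (fun b : j.NilGroup => a⁻¹ * b) a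

theorem leftDifferential_eq (a : j.NilGroup) :
    j.leftDifferential a = ContinuousLinearMap.id ℝ j.NilGroup - (1 / 2 : ℝ) • j.bracketL a := by
  have h : HasFDerivAt (fun b : j.NilGroup => a⁻¹ * b)
      (0 + ContinuousLinearMap.id ℝ j.NilGroup + (1 / 2 : ℝ) • j.bracketL (-a)) a := by
    simp only [mul_def, inv_def]
    exact ((hasFDerivAt_const (-a) a).add (hasFDerivAt_id a)).add
      ((j.bracketL (-a)).hasFDerivAt.const_smul (1 / 2 : ℝ))
  rw [leftDifferential, h.fderiv, map_neg, smul_neg, zero_add, sub_eq_add_neg]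

/-- The left-invariant Riemannian metric `g(j)` on `G(j)` which is the given inner product of
`𝔤(j)` at the identity: `g(j)_a(u,v) = ⟨d(L_{a⁻¹}) u, d(L_{a⁻¹}) v⟩`. -/
def metric : SmoothMetric j.NilGroup where
  val a := (innerSL ℝ : j.NilGroup →L[ℝ] j.NilGroup →L[ℝ] ℝ).bilinearComp
    (j.leftDifferential a) (j.leftDifferential a)
  smooth := by
    have hD : ContDiff ℝ ∞ j.leftDifferential := by
      have : j.leftDifferential = fun a =>
          ContinuousLinearMap.id ℝ j.NilGroup - (1 / 2 : ℝ) • j.bracketL a :=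
        funext j.leftDifferential_eq
      rw [this]
      exact contDiff_const.sub (j.bracketL.contDiff.const_smul (1 / 2 : ℝ))
    rw [contDiff_clm_apply_iff]
    intro u
    rw [contDiff_clm_apply_iff]
    intro v
    exact (hD.clm_apply contDiff_const).inner ℝ (hD.clm_apply contDiff_const)
  symm a u v := real_inner_comm (j.leftDifferential a v) (j.leftDifferential a u)
  pos a u hu := by
    change 0 < ⟪j.leftDifferential a u, j.leftDifferential a u⟫
    refine real_inner_self_pos.mpr fun h0 => hu ?_
    rw [leftDifferential_eq] at h0
    have h1 : u = (1 / 2 : ℝ) • j.bracketL a u := sub_eq_zero.mp h0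
    have h2 : j.bracketL a u = 0 := by
      have h3 := congrArg (j.bracketL a) h1
      rwa [map_smul, bracketL_right, smul_zero] at h3
    rw [h1, h2, smul_zero]

/-- The polynomial invariant
`I_{k_1…k_λ|…|k_μ…k_{2q}}(j) = ∑ Tr(j_{Z_{α(k_1)}} ⋯ j_{Z_{α(k_λ)}}) ⋯ Tr(j_{Z_{α(k_μ)}} ⋯ j_{Z_{α(k_{2q})}})`,
the sum being over all `α : {1,…,q} → {1,…,r}`. The bars, which cut the tuple `k` into nonempty
blocks of consecutive entries, are encoded by a composition `c` of `2q`. -/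
def traceInvariant {q : ℕ} (k : Fin (2 * q) → Fin q) (c : Composition (2 * q)) : ℝ :=
  ∑ α : Fin q → Fin r,
    (((List.ofFn fun i => j.basisEnd (α (k i))).splitWrtComposition c).map fun block =>
      LinearMap.trace ℝ (EuclideanSpace ℝ (Fin m)) block.prod).prod

end JMap

/-- The index data of a trace invariant of order `2q`: a tuple `k_1 … k_{2q}` in `{1,…,q}` in which
each entry occurs exactly twice, together with a choice of bars. -/
abbrev TraceIndex (q : ℕ) : Type :=
  {k : Fin (2 * q) → Fin q // ∀ i, (Finset.univ.filter fun s => k s = i).card = 2} ×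
    Composition (2 * q)

end

/-! Trivialise the tangent bundle of `G(j)` by left translations. Then `∇^p R` becomes one fixed
tensor on `𝔤(j)`, whose components in an orthonormal basis are homogeneous polynomials of degree `p
+ 2` in the structure constants `⟨[u, v], w⟩` (`nablaCurvature_eq`, `eval_nablaCurvaturePoly`). An
invariant of order `2q` is therefore a linear functional of the `2q`-th tensor power of the
structure constants, and its value does not depend on the orthonormal basis. Projecting that
functional to the span of these tensor powers, for all `m`, `r`, `j` of total dimension `n` at once,
gives an `O(n)`-invariant tensor (`exists_orthogonalInvariant_dotProduct_eq`). By the first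
fundamental theorem (`orthogonalInvariants_eq_pairingSpan`) it is a combination of products of
Kronecker deltas, so the invariant is a combination of complete contractions, with coefficients
independent of `m`, `r`, `j`.

Each contraction is computed in the standard basis (`exists_contraction_eq`). A structure constant
vanishes unless its first two slots lie in `𝔳` and its third in `𝔷`, and then it is an entry of some
`j_{Z_α}`. So third slots must be paired with third slots, which yields the sum over `α`. The
pairing of the remaining slots is a graph whose edges are matrices and whose vertices have degree
two, a union of cycles. Since transposing a skew matrix costs only a sign, the edges of a cycle can
be oriented consistently, and the cycle gives a trace (`isTraceProduct_of_labelDegree`).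

The fundamental theorem is proved with a Gaussian random matrix `G`. By Wick's formula the
expectation of `G^{⊗S}` maps every tensor into the span of the delta products. On invariant tensors
it is positive definite: in the polar decomposition `G = R O` the factor `O` acts trivially and `R`
acts as a positive operator. Hence it embeds the invariants into that span, and the opposite
inclusion is elementary. -/

noncomputable section

set_option linter.unusedSectionVars false

/-! ### Moments of the standard Gaussian measure -/

open MeasureTheory ProbabilityTheory in
theorem integrable_pow_gaussianReal (k : ℕ) :
    Integrable (fun x : ℝ => x ^ k) (gaussianReal 0 1) := by
  have h := (memLp_id_gaussianReal (μ := 0) (v := 1) (k : NNReal)).integrable_norm_pow'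
  simp only [id] at h
  refine h.mono (by fun_prop) (Filter.Eventually.of_forall fun x => ?_)
  simp

open MeasureTheory ProbabilityTheory in
theorem integrable_pow_mul_gaussianPDFReal (k : ℕ) :
    Integrable (fun x : ℝ => x ^ k * gaussianPDFReal 0 1 x) := by
  have h := integrable_pow_gaussianReal k
  rw [gaussianReal_of_var_ne_zero 0 one_ne_zero, gaussianPDF_def,
    integrable_withDensity_iff (by fun_prop)
      (Filter.Eventually.of_forall fun _ => ENNReal.ofReal_lt_top)] at h
  refine h.congr (Filter.Eventually.of_forall fun x => ?_)
  simp [ENNReal.toReal_ofReal (gaussianPDFReal_nonneg 0 1 x)]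

/-- The moments of the standard Gaussian measure on the line. -/
def gaussianMoment (k : ℕ) : ℝ := ∫ x, x ^ k ∂(ProbabilityTheory.gaussianReal 0 1)

open MeasureTheory ProbabilityTheory in
theorem gaussianMoment_eq (k : ℕ) :
    gaussianMoment k = ∫ x, x ^ k * gaussianPDFReal 0 1 x := by
  rw [gaussianMoment, integral_gaussianReal_eq_integral_smul one_ne_zero]
  simp [mul_comm]

open ProbabilityTheory in
theorem hasDerivAt_gaussianPDFReal (x : ℝ) :
    HasDerivAt (gaussianPDFReal 0 1) (-(x * gaussianPDFReal 0 1 x)) x := by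
  have h : gaussianPDFReal 0 1 =
      fun x => (Real.sqrt (2 * Real.pi))⁻¹ * Real.exp (-(x ^ 2 / 2)) := by
    funext x
    simp [gaussianPDFReal_def, neg_div]
  rw [h]
  have h2 : HasDerivAt (fun x : ℝ => -(x ^ 2 / 2)) (-x) x := by
    refine ((hasDerivAt_pow 2 x).div_const 2).neg.congr_deriv ?_
    simp
  refine (h2.exp.const_mul (Real.sqrt (2 * Real.pi))⁻¹).congr_deriv ?_
  ring

-- Integration by parts against the density, whose derivative is `-x` times itself. For `k = 0` the
-- truncated `k - 1` is harmless because of the factor `k`.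
open MeasureTheory ProbabilityTheory in
theorem gaussianMoment_succ (k : ℕ) :
    gaussianMoment (k + 1) = k * gaussianMoment (k - 1) := by
  rw [gaussianMoment_eq, gaussianMoment_eq]
  have h := integral_mul_deriv_eq_deriv_mul_of_integrable
    (u := fun x : ℝ => x ^ k) (u' := fun x => k * x ^ (k - 1)) (v := gaussianPDFReal 0 1)
    (v' := fun x => -(x * gaussianPDFReal 0 1 x))
    (fun x _ => hasDerivAt_pow k x) (fun x _ => hasDerivAt_gaussianPDFReal x)
    (by
      refine (integrable_pow_mul_gaussianPDFReal (k + 1)).neg.congr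
        (Filter.Eventually.of_forall fun x => ?_)
      simp; ring)
    (by
      refine ((integrable_pow_mul_gaussianPDFReal (k - 1)).const_mul k).congr
        (Filter.Eventually.of_forall fun x => ?_)
      simp; ring)
    (integrable_pow_mul_gaussianPDFReal k)
  have h1 : ∫ x : ℝ, x ^ k * -(x * gaussianPDFReal 0 1 x)
      = -∫ x : ℝ, x ^ (k + 1) * gaussianPDFReal 0 1 x := by
    rw [← integral_neg]; congr 1; funext x; ring
  have h2 : ∫ x : ℝ, k * x ^ (k - 1) * gaussianPDFReal 0 1 x
      = k * ∫ x : ℝ, x ^ (k - 1) * gaussianPDFReal 0 1 x := by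
    rw [← integral_const_mul]; congr 1; funext x; ring
  rw [h1, h2] at h
  linarith

-- Full support is what later turns positivity at one point into positivity of an integral.
open MeasureTheory ProbabilityTheory in
instance isOpenPosMeasure_gaussianReal :
    (gaussianReal 0 1).IsOpenPosMeasure :=
  (gaussianReal_absolutelyContinuous' 0 one_ne_zero).isOpenPosMeasure

/-- The law of a family of independent standard Gaussian variables. -/
def gaussianPi (I : Type*) [Fintype I] : MeasureTheory.Measure (I → ℝ) :=
  MeasureTheory.Measure.pi fun _ => ProbabilityTheory.gaussianReal 0 1

instance (I : Type*) [Fintype I] : (gaussianPi I).IsOpenPosMeasure := by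
  unfold gaussianPi; infer_instance

/-! ### Wick's recursion for products of independent Gaussian variables -/

section Wick
variable {S I : Type*} [Fintype I] [DecidableEq I]

theorem prod_eval_eq_prod_pow (T : Finset S) (c : S → I) (x : I → ℝ) :
    ∏ s ∈ T, x (c s) = ∏ a, x a ^ (T.filter fun s => c s = a).card := by
  rw [← Finset.prod_fiberwise T c]
  refine Finset.prod_congr rfl fun a _ => ?_
  rw [Finset.prod_congr rfl (g := fun _ => x a), Finset.prod_const]
  intro s hs
  rw [(Finset.mem_filter.mp hs).2]

open MeasureTheory in
theorem integrable_prod_eval (T : Finset S) (c : S → I) :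
    Integrable (fun x : I → ℝ => ∏ s ∈ T, x (c s)) (gaussianPi I) := by
  simp only [prod_eval_eq_prod_pow]
  exact Integrable.fintype_prod (fun a => integrable_pow_gaussianReal _)

/-- The mixed moments of a family of independent standard Gaussian variables. -/
def mixedMoment (T : Finset S) (c : S → I) : ℝ :=
  ∏ a, gaussianMoment (T.filter fun s => c s = a).card

open MeasureTheory in
theorem integral_prod_eval (T : Finset S) (c : S → I) :
    ∫ x, ∏ s ∈ T, x (c s) ∂(gaussianPi I) = mixedMoment T c := by
  simp only [prod_eval_eq_prod_pow]
  exact integral_fintype_prod_eq_prod (fun a (x : ℝ) => x ^ (T.filter fun s => c s = a).card)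

theorem mixedMoment_empty (c : S → I) : mixedMoment ∅ c = 1 := by
  simp [mixedMoment, gaussianMoment]

/-- Only the factor of the variable `c s` is affected. If that variable occurs `k` times in `T`, the
nonzero summands on the right are `k` equal terms, and the claim is the recursion
`gaussianMoment_succ`. -/
theorem mixedMoment_insert [DecidableEq S] {T : Finset S} {s : S} (hs : s ∉ T) (c : S → I) :
    mixedMoment (insert s T) c =
      ∑ t ∈ T, if c s = c t then mixedMoment (T.erase t) c else 0 := by
  have hR : ∀ t ∈ T.filter (fun t => c t = c s), mixedMoment (T.erase t) c =
      gaussianMoment ((T.filter fun t => c t = c s).card - 1) *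
        ∏ a ∈ Finset.univ.erase (c s), gaussianMoment (T.filter fun t => c t = a).card := by
    intro t ht
    rw [Finset.mem_filter] at ht
    rw [mixedMoment, ← Finset.mul_prod_erase _ _ (Finset.mem_univ (c s))]
    congr 1
    · rw [Finset.filter_erase, Finset.card_erase_of_mem (by simp [ht])]
    · refine Finset.prod_congr rfl fun a ha => ?_
      rw [Finset.filter_erase, Finset.erase_eq_of_notMem]
      simp only [Finset.mem_filter, not_and]
      intro _ h
      exact (Finset.mem_erase.mp ha).1 (h.symm.trans ht.2)
  rw [← Finset.sum_filter]
  have hf : T.filter (fun t => c s = c t) = T.filter (fun t => c t = c s) := by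
    simp only [eq_comm]
  rw [hf, Finset.sum_congr rfl hR, Finset.sum_const, nsmul_eq_mul, ← mul_assoc,
    ← gaussianMoment_succ, mixedMoment, ← Finset.mul_prod_erase _ _ (Finset.mem_univ (c s))]
  congr 1
  · rw [Finset.filter_insert, if_pos rfl, Finset.card_insert_of_notMem (by simp [hs])]
  · refine Finset.prod_congr rfl fun a ha => ?_
    rw [Finset.filter_insert, if_neg (Finset.mem_erase.mp ha).1.symm]

end Wick

/-! ### The first fundamental theorem of invariant theory for the orthogonal group -/

section FirstFundamentalTheorem
open Matrix
variable {S ι : Type*} [Fintype S] [DecidableEq S] [Fintype ι] [DecidableEq ι]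

theorem ite_congr_of_iff {α : Sort*} {p q : Prop} {_ : Decidable p} {_ : Decidable q} {a b : α}
    (h : p ↔ q) : (if p then a else b) = if q then a else b :=
  if_congr h rfl rfl

/-- The action of a matrix on tensors with index slots `S`. -/
def tensorPower (S : Type*) [Fintype S] {ι : Type*} (A : Matrix ι ι ℝ) :
    Matrix (S → ι) (S → ι) ℝ :=
  Matrix.of fun i k => ∏ s, A (i s) (k s)

theorem tensorPower_one : tensorPower S (1 : Matrix ι ι ℝ) = 1 := by
  ext i k
  simp only [tensorPower, of_apply, one_apply, Finset.prod_ite_zero, Finset.prod_const_one,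
    Finset.mem_univ, true_imp_iff, funext_iff]

theorem tensorPower_mul (A B : Matrix ι ι ℝ) :
    tensorPower S (A * B) = tensorPower S A * tensorPower S B := by
  ext i k
  simp only [tensorPower, of_apply, mul_apply, Finset.prod_univ_sum, Fintype.piFinset_univ,
    Finset.prod_mul_distrib]

theorem tensorPower_transpose (A : Matrix ι ι ℝ) :
    tensorPower S Aᵀ = (tensorPower S A)ᵀ := rfl

theorem continuous_tensorPower (i k : S → ι) :
    Continuous fun A : Matrix ι ι ℝ => tensorPower S A i k := by
  simp only [tensorPower, of_apply]
  exact continuous_finsetProd _ fun s _ => Continuous.matrix_elem continuous_id _ _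

/-- The tensors that are invariant under the orthogonal group. -/
def orthogonalInvariants (S ι : Type*) [Fintype S] [DecidableEq S] [Fintype ι]
    [DecidableEq ι] : Submodule ℝ ((S → ι) → ℝ) where
  carrier := {t | ∀ A : Matrix ι ι ℝ, A * Aᵀ = 1 → tensorPower S A *ᵥ t = t}
  add_mem' ha hb A hA := by rw [mulVec_add, ha A hA, hb A hA]
  zero_mem' A _ := mulVec_zero _
  smul_mem' c t ht A hA := by rw [mulVec_smul, ht A hA]

/-- `π : S → E` groups the slots in `T` into pairs. -/
def IsPairingOn {S E : Type*} [DecidableEq E] (T : Finset S) (π : S → E) : Prop :=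
  ∀ s ∈ T, (T.filter fun t => π t = π s).card = 2

/-- The tensor which is the product of Kronecker deltas of the pairs of slots in `T`. -/
def pairingTensor {S E : Type*} [DecidableEq E] (ι : Type*) [DecidableEq ι] (T : Finset S)
    (π : S → E) (i : S → ι) : ℝ :=
  if ∀ s ∈ T, ∀ t ∈ T, π s = π t → i s = i t then 1 else 0

/-- The span of all products of Kronecker deltas. -/
def pairingSpan {S : Type*} (ι : Type*) [DecidableEq ι] (T : Finset S) :
    Submodule ℝ ((S → ι) → ℝ) :=
  Submodule.span ℝ {t | ∃ (E : Type) (_ : Fintype E) (_ : DecidableEq E) (π : S → E),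
    IsPairingOn T π ∧ t = pairingTensor ι T π}

theorem mul_mem_pairingSpan {T : Finset S} {s t : S} (hs : s ∉ T) (ht : t ∉ T) (hst : s ≠ t)
    {F : (S → ι) → ℝ} (hF : F ∈ pairingSpan ι T) :
    (fun i => if i s = i t then F i else 0) ∈ pairingSpan ι (insert s (insert t T)) := by
  let L : ((S → ι) → ℝ) →ₗ[ℝ] ((S → ι) → ℝ) :=
    { toFun := fun F i => if i s = i t then F i else 0
      map_add' := fun F G => by ext i; by_cases h : i s = i t <;> simp [h]
      map_smul' := fun c F => by ext i; by_cases h : i s = i t <;> simp [h] }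
  have hle : pairingSpan ι T ≤ (pairingSpan ι (insert s (insert t T))).comap L := by
    refine Submodule.span_le.mpr ?_
    rintro _ ⟨E, _, _, π, hπ, rfl⟩
    -- The new pair `{s, t}` receives the fresh label `none`.
    refine Submodule.subset_span ⟨Option E, inferInstance, inferInstance,
      fun u => if u = s ∨ u = t then none else some (π u), ?_, ?_⟩
    · intro v hv
      by_cases hv' : v = s ∨ v = t
      · have : (insert s (insert t T)).filter (fun u => (if u = s ∨ u = t then none else some (π u))
            = (if v = s ∨ v = t then none else some (π v))) = {s, t} := by
          ext u
          simp only [Finset.mem_filter, Finset.mem_insert, Finset.mem_singleton, hv', if_true]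
          by_cases h : u = s ∨ u = t <;> simp [h]
          tauto
        rw [this, Finset.card_pair hst]
      · have hvT : v ∈ T := by simp only [Finset.mem_insert] at hv; tauto
        rw [← hπ v hvT]
        congr 1
        ext u
        simp only [Finset.mem_filter, Finset.mem_insert, hv', if_false]
        by_cases h : u = s ∨ u = t
        · simp only [h, if_true, reduceCtorEq, and_false, false_iff, not_and]
          rcases h with rfl | rfl <;> tauto
        · simp only [h, if_false, Option.some.injEq]
          tauto
    · funext i
      have hne : ∀ u ∈ T, ¬ (u = s ∨ u = t) := by
        rintro u hu (rfl | rfl) <;> contradiction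
      change (if i s = i t then pairingTensor ι T π i else 0) = _
      simp only [pairingTensor, ← ite_and]
      refine ite_congr_of_iff ⟨?_, ?_⟩
      · rintro ⟨h1, h2⟩ u hu v hv huv
        by_cases h3 : u = s ∨ u = t <;> by_cases h4 : v = s ∨ v = t
        · rcases h3 with rfl | rfl <;> rcases h4 with rfl | rfl <;> simp [h1]
        · simp [h3, h4] at huv
        · simp [h3, h4] at huv
        · simp only [h3, h4, if_false, Option.some.injEq] at huv
          simp only [Finset.mem_insert] at hu hv
          exact h2 u (by tauto) v (by tauto) huv
      · intro h
        refine ⟨h s (by simp) t (by simp) (by simp), fun u hu v hv huv => ?_⟩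
        refine h u (by simp [hu]) v (by simp [hv]) ?_
        simp [hne u hu, hne v hv, huv]
  exact hle hF

/-- Wick's formula: mixed moments of a Gaussian matrix are sums over pairings. -/
theorem mixedMoment_mem_pairingSpan (k : S → ι) (N : ℕ) : ∀ T : Finset S, T.card = N →
    (fun i : S → ι => mixedMoment T fun s => (i s, k s)) ∈ pairingSpan ι T := by
  induction N using Nat.strong_induction_on with
  | _ N ih =>
    intro T hT
    rcases T.eq_empty_or_nonempty with rfl | ⟨s, hs⟩
    · refine Submodule.subset_span ⟨Unit, inferInstance, inferInstance, fun _ => (), ?_, ?_⟩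
      · simp [IsPairingOn]
      · funext i
        simp [mixedMoment_empty, pairingTensor]
    · have hT' : T = insert s (T.erase s) := (Finset.insert_erase hs).symm
      have hs' := Finset.notMem_erase s T
      generalize T.erase s = T' at hT' hs'
      subst hT'
      -- Equality of the matrix positions `(i s, k s)` and `(i t, k t)` splits into a delta in the
      -- row indices, which extends the pairing by `{s, t}`, and a constant depending on `k`.
      have : (fun i : S → ι => mixedMoment (insert s T') fun s => (i s, k s)) =
          ∑ t ∈ T', (if k s = k t then (1 : ℝ) else 0) •
            fun i => if i s = i t then mixedMoment (T'.erase t) (fun s => (i s, k s)) else 0 := by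
        funext i
        rw [mixedMoment_insert hs', Finset.sum_apply]
        refine Finset.sum_congr rfl fun t _ => ?_
        by_cases h1 : i s = i t <;> by_cases h2 : k s = k t <;> simp [h1, h2]
      rw [this]
      refine Submodule.sum_mem _ fun t ht => Submodule.smul_mem _ _ ?_
      have hst : s ≠ t := fun h => hs' (h ▸ ht)
      have := mul_mem_pairingSpan (s := s) (t := t) (T := T'.erase t)
        (by simp [hs']) (by simp) hst (ih (T'.erase t).card (by
          rw [← hT, Finset.card_insert_of_notMem hs']
          exact Nat.lt_succ_of_lt (Finset.card_erase_lt_of_mem ht)) _ rfl)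
      rwa [Finset.insert_erase ht] at this

/-- The tensor is the indicator of the index families that factor through `π`. Surjectivity makes
the factorisation unique, so each family is counted once. -/
theorem sum_pairingTensor_mul {E : Type*} [Fintype E] [DecidableEq E] {π : S → E}
    (hπ : Function.Surjective π) (F : (S → ι) → ℝ) :
    ∑ i, pairingTensor ι Finset.univ π i * F i = ∑ a : E → ι, F (a ∘ π) := by
  classical
  have h : ∀ i, pairingTensor ι Finset.univ π i * F i =
      if i ∈ Finset.univ.image (fun a : E → ι => a ∘ π) then F i else 0 := by
    intro i
    simp only [pairingTensor, Finset.mem_univ, true_imp_iff, Finset.mem_image, true_and, ite_mul,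
      one_mul, zero_mul]
    refine ite_congr_of_iff ⟨fun h => ⟨i ∘ Function.surjInv hπ, ?_⟩, ?_⟩
    · funext s
      exact h _ _ (Function.surjInv_eq hπ (π s))
    · rintro ⟨a, rfl⟩ s t hst
      exact congrArg a hst
  rw [Finset.sum_congr rfl fun i _ => h i, Finset.sum_ite_mem, Finset.univ_inter,
    Finset.sum_image (hπ.injective_comp_right.injOn)]

theorem pairingTensor_mem_orthogonalInvariants {E : Type*} [Fintype E] [DecidableEq E]
    {π : S → E} (hπ : IsPairingOn Finset.univ π) (hs : Function.Surjective π) :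
    pairingTensor ι Finset.univ π ∈ orthogonalInvariants S ι := by
  intro A hA
  funext i
  have h1 : (tensorPower S A *ᵥ pairingTensor ι Finset.univ π) i =
      ∑ a : E → ι, ∏ s, A (i s) (a (π s)) := by
    refine Eq.trans ?_ (sum_pairingTensor_mul hs (fun k => ∏ s, A (i s) (k s)))
    simp only [mulVec, dotProduct, tensorPower, of_apply, mul_comm]
  -- The sum belonging to one pair of slots is an entry of `A * Aᵀ = 1`, that is, a Kronecker delta.
  have h2 : ∀ e, ∑ x, ∏ s ∈ Finset.univ.filter (fun s => π s = e), A (i s) x =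
      if ∀ s t, π s = e → π t = e → i s = i t then 1 else 0 := by
    intro e
    obtain ⟨u, rfl⟩ := hs e
    obtain ⟨v, w, hvw, hf⟩ := Finset.card_eq_two.mp (hπ u (Finset.mem_univ _))
    have hm : ∀ s, π s = π u ↔ s = v ∨ s = w := fun s => by
      have := Finset.ext_iff.mp hf s
      simpa using this
    simp only [hf, Finset.prod_pair hvw]
    have h3 := congrFun (congrFun hA (i v)) (i w)
    rw [mul_apply, one_apply] at h3
    simp only [transpose_apply] at h3
    rw [h3]
    refine ite_congr_of_iff ⟨fun h s t hs ht => ?_, fun h => h v w ?_ ?_⟩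
    · rw [hm] at hs ht
      rcases hs with rfl | rfl <;> rcases ht with rfl | rfl <;> simp [h]
    · simp [hm]
    · simp [hm]
  rw [h1]
  calc ∑ a : E → ι, ∏ s, A (i s) (a (π s))
      = ∑ a : E → ι, ∏ e, ∏ s ∈ Finset.univ.filter (fun s => π s = e), A (i s) (a e) := by
        refine Finset.sum_congr rfl fun a _ => ?_
        rw [← Finset.prod_fiberwise Finset.univ π]
        refine Finset.prod_congr rfl fun e _ => Finset.prod_congr rfl fun s hs => ?_
        rw [(Finset.mem_filter.mp hs).2]
    _ = ∏ e, ∑ x, ∏ s ∈ Finset.univ.filter (fun s => π s = e), A (i s) x := by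
        rw [Finset.prod_univ_sum, Fintype.piFinset_univ]
    _ = pairingTensor ι Finset.univ π i := by
        rw [Finset.prod_congr rfl fun e _ => h2 e, pairingTensor]
        refine (Finset.prod_ite_zero).trans ?_
        rw [Finset.prod_const_one]
        refine ite_congr_of_iff ⟨fun h s _ t _ hst => h (π t) (Finset.mem_univ _) s t hst rfl,
          fun h e _ s t hs ht => h s (Finset.mem_univ _) t (Finset.mem_univ _) (hs.trans ht.symm)⟩

/-- Labels outside the range of `π` play no role and can be discarded. -/
theorem pairingSpan_univ_eq : pairingSpan ι (Finset.univ : Finset S) =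
    Submodule.span ℝ {t | ∃ (E : Type) (_ : Fintype E) (_ : DecidableEq E) (π : S → E),
      IsPairingOn Finset.univ π ∧ Function.Surjective π ∧ t = pairingTensor ι Finset.univ π} := by
  classical
  refine le_antisymm (Submodule.span_mono ?_) (Submodule.span_mono ?_)
  · rintro t ⟨E, _, _, π, hπ, rfl⟩
    refine ⟨Set.range π, inferInstance, inferInstance, Set.rangeFactorization π, ?_,
      Set.rangeFactorization_surjective, ?_⟩
    · intro s hs
      rw [← hπ s hs]
      simp [Subtype.ext_iff]
    · funext i
      simp [pairingTensor, Subtype.ext_iff]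
  · rintro t ⟨E, h1, h2, π, hπ, -, rfl⟩
    exact ⟨E, h1, h2, π, hπ, rfl⟩

theorem pairingSpan_le_orthogonalInvariants :
    pairingSpan ι (Finset.univ : Finset S) ≤ orthogonalInvariants S ι := by
  rw [pairingSpan_univ_eq, Submodule.span_le]
  rintro t ⟨E, _, _, π, hπ, hs, rfl⟩
  exact pairingTensor_mem_orthogonalInvariants hπ hs

/-! ### Positivity of matrix actions on invariant tensors -/

section Positivity
open scoped MatrixOrder ComplexOrder

theorem dotProduct_tensorPower_nonneg_of_det_ne_zero {t : (S → ι) → ℝ}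
    (ht : t ∈ orthogonalInvariants S ι) (A : Matrix ι ι ℝ) (hA : A.det ≠ 0) :
    0 ≤ t ⬝ᵥ (tensorPower S A *ᵥ t) := by
  have hp : 0 ≤ A * Aᵀ := by
    have := Matrix.posSemidef_self_mul_conjTranspose A
    rw [conjTranspose_eq_transpose_of_trivial] at this
    exact this.nonneg
  -- Polar decomposition `A = R * (R⁻¹ * A)` with `R` the square root of `A * Aᵀ`. The orthogonal
  -- factor fixes `t`, and writing `R = Bᵀ * B` turns the form into the squared length of
  -- `tensorPower S B *ᵥ t`.
  obtain ⟨R, hR, hR0⟩ : ∃ R, R * R = A * Aᵀ ∧ 0 ≤ R :=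
    ⟨CFC.sqrt (A * Aᵀ), CFC.sqrt_mul_sqrt_self _ hp, CFC.sqrt_nonneg _⟩
  obtain ⟨B, hB⟩ := CStarAlgebra.nonneg_iff_eq_star_mul_self.mp hR0
  rw [star_eq_conjTranspose, conjTranspose_eq_transpose_of_trivial] at hB
  have hRt : Rᵀ = R := by rw [hB]; simp
  have hRu : IsUnit R.det := by
    have h := congrArg Matrix.det hR
    rw [det_mul, det_mul, det_transpose] at h
    refine isUnit_iff_ne_zero.mpr fun h0 => ?_
    rw [h0, zero_mul] at h
    exact hA (mul_self_eq_zero.mp h.symm)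
  have hO : (R⁻¹ * A) * (R⁻¹ * A)ᵀ = 1 := by
    rw [transpose_mul, transpose_nonsing_inv, hRt, Matrix.mul_assoc, ← Matrix.mul_assoc A, ← hR,
      Matrix.mul_assoc R, mul_nonsing_inv _ hRu, Matrix.mul_one, nonsing_inv_mul _ hRu]
  have hARO : A = R * (R⁻¹ * A) := by
    rw [← Matrix.mul_assoc, mul_nonsing_inv _ hRu, Matrix.one_mul]
  rw [hARO, tensorPower_mul, ← mulVec_mulVec, ht _ hO, hB, tensorPower_mul, ← mulVec_mulVec,
    tensorPower_transpose, dotProduct_mulVec, vecMul_transpose]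
  exact Finset.sum_nonneg fun i _ => mul_self_nonneg _

theorem continuous_dotProduct_tensorPower (t : (S → ι) → ℝ) :
    Continuous fun A : Matrix ι ι ℝ => t ⬝ᵥ (tensorPower S A *ᵥ t) := by
  simp only [dotProduct, mulVec]
  have := fun i k => continuous_tensorPower (S := S) (ι := ι) i k
  fun_prop

theorem dotProduct_tensorPower_nonneg {t : (S → ι) → ℝ}
    (ht : t ∈ orthogonalInvariants S ι) (A : Matrix ι ι ℝ) :
    0 ≤ t ⬝ᵥ (tensorPower S A *ᵥ t) := by
  -- `ε + A` is singular only at the finitely many roots of the characteristic polynomial of `-A`.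
  -- The singular case thus follows by letting `ε` tend to `0` through other values.
  have hev : ∀ᶠ ε in nhdsWithin (0 : ℝ) {0}ᶜ, (Matrix.scalar ι ε - (-A)).det ≠ 0 := by
    have hfin : Set.Finite {ε : ℝ | (-A).charpoly.IsRoot ε} :=
      Polynomial.finite_setOfPred_isRoot (charpoly_monic _).ne_zero
    have := (hfin.subset Set.sdiff_subset : Set.Finite
      ({ε : ℝ | (-A).charpoly.IsRoot ε} \ {0})).isClosed.isOpen_compl.mem_nhds (x := 0) (by simp)
    filter_upwards [nhdsWithin_le_nhds this, self_mem_nhdsWithin] with ε h1 h2 h3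
    rw [← Matrix.eval_charpoly] at h3
    exact h1 ⟨h3, h2⟩
  have hlim : Filter.Tendsto (fun ε : ℝ => t ⬝ᵥ (tensorPower S (Matrix.scalar ι ε - (-A)) *ᵥ t))
      (nhdsWithin 0 {0}ᶜ) (nhds (t ⬝ᵥ (tensorPower S A *ᵥ t))) := by
    have hc : Continuous fun ε : ℝ => Matrix.scalar ι ε - (-A) := by
      simp only [scalar_apply]
      fun_prop
    have h := ((continuous_dotProduct_tensorPower t).comp hc).tendsto 0
    simp only [Function.comp_def, map_zero, zero_sub, neg_neg] at h
    exact h.mono_left nhdsWithin_le_nhds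
  exact ge_of_tendsto hlim (hev.mono fun ε hε => dotProduct_tensorPower_nonneg_of_det_ne_zero ht _ hε)

end Positivity

/-- The average of the action of a Gaussian random matrix on tensors. -/
def gaussianAverage (S ι : Type*) [Fintype S] [DecidableEq S] [Fintype ι] [DecidableEq ι] :
    Matrix (S → ι) (S → ι) ℝ :=
  Matrix.of fun i k => mixedMoment Finset.univ fun s => (i s, k s)

theorem gaussianAverage_mulVec_mem (t : (S → ι) → ℝ) :
    gaussianAverage S ι *ᵥ t ∈ pairingSpan ι (Finset.univ : Finset S) := by
  have : gaussianAverage S ι *ᵥ t =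
      ∑ k, t k • fun i => mixedMoment Finset.univ fun s => (i s, k s) := by
    funext i
    simp [mulVec, dotProduct, gaussianAverage, mul_comm, Finset.sum_apply]
  rw [this]
  exact Submodule.sum_mem _ fun k _ =>
    Submodule.smul_mem _ _ (mixedMoment_mem_pairingSpan k _ _ rfl)

open MeasureTheory in
theorem dotProduct_gaussianAverage_pos {t : (S → ι) → ℝ}
    (ht : t ∈ orthogonalInvariants S ι) (h0 : t ≠ 0) :
    0 < t ⬝ᵥ (gaussianAverage S ι *ᵥ t) := by
  let f : (ι × ι → ℝ) → ℝ := fun x => t ⬝ᵥ (tensorPower S (Matrix.of fun a b => x (a, b)) *ᵥ t)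
  have hf : f = fun x => ∑ i, ∑ k, t i * t k * ∏ s, x (i s, k s) := by
    funext x
    simp only [f, dotProduct, mulVec, tensorPower, of_apply, Finset.mul_sum]
    refine Finset.sum_congr rfl fun i _ => Finset.sum_congr rfl fun k _ => by ring
  have hint : ∀ i k, Integrable (fun x : ι × ι → ℝ => t i * t k * ∏ s, x (i s, k s))
      (gaussianPi (ι × ι)) := fun i k =>
    (integrable_prod_eval Finset.univ fun s => (i s, k s)).const_mul _
  have hI : t ⬝ᵥ (gaussianAverage S ι *ᵥ t) = ∫ x, f x ∂(gaussianPi (ι × ι)) := by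
    rw [hf, integral_finsetSum _ fun i _ => integrable_finsetSum _ fun k _ => hint i k]
    simp only [dotProduct, mulVec, Finset.mul_sum]
    refine Finset.sum_congr rfl fun i _ => ?_
    rw [integral_finsetSum _ fun k _ => hint i k]
    refine Finset.sum_congr rfl fun k _ => ?_
    rw [integral_const_mul, integral_prod_eval, gaussianAverage, of_apply]
    ring
  have hcont : Continuous f := by
    rw [hf]; fun_prop
  rw [hI, integral_pos_iff_support_of_nonneg (fun x => dotProduct_tensorPower_nonneg ht _)
    (by
      change Integrable f _
      rw [hf]
      exact integrable_finsetSum _ fun i _ => integrable_finsetSum _ fun k _ => hint i k)]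
  -- The integrand is continuous and nonnegative, and at the identity matrix it equals `t ⬝ᵥ t ≠ 0`.
  refine (hcont.isOpen_support).measure_pos _ ⟨fun p => (1 : Matrix ι ι ℝ) p.1 p.2, ?_⟩
  change t ⬝ᵥ (tensorPower S (1 : Matrix ι ι ℝ) *ᵥ t) ≠ 0
  rw [tensorPower_one, one_mulVec]
  exact fun h => h0 (dotProduct_self_eq_zero.mp h)

/-- The first fundamental theorem: every orthogonally invariant tensor is a linear combination of
products of Kronecker deltas. -/
theorem orthogonalInvariants_eq_pairingSpan :
    orthogonalInvariants S ι = pairingSpan ι (Finset.univ : Finset S) := by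
  refine (Submodule.eq_of_le_of_finrank_le pairingSpan_le_orthogonalInvariants ?_).symm
  -- Averaging is injective on invariants by strict positivity, which bounds their dimension by that
  -- of the pairing span.
  let Φ : orthogonalInvariants S ι →ₗ[ℝ] pairingSpan ι (Finset.univ : Finset S) :=
    ((gaussianAverage S ι).mulVecLin.comp (orthogonalInvariants S ι).subtype).codRestrict _
      fun t => gaussianAverage_mulVec_mem _
  refine LinearMap.finrank_le_finrank_of_injective (f := Φ) ?_
  rw [← LinearMap.ker_eq_bot, LinearMap.ker_eq_bot']
  intro t ht
  by_contra hne
  have h1 := dotProduct_gaussianAverage_pos t.2 (fun h => hne (Subtype.ext h))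
  have h2 : gaussianAverage S ι *ᵥ (t : (S → ι) → ℝ) = 0 := congrArg Subtype.val ht
  rw [h2, dotProduct_zero] at h1
  exact lt_irrefl _ h1

end FirstFundamentalTheorem

/-! ### The curvature of a left-invariant metric in terms of the Lie algebra -/

namespace JMap
variable {m r : ℕ} (j : JMap m r)

theorem bracketL_swap (u v : j.NilGroup) : j.bracketL v u = -j.bracketL u v := by
  have h := j.bracketL_self (u + v)
  simp only [map_add, add_apply, bracketL_self, zero_add, add_zero] at h
  exact eq_neg_of_add_eq_zero_left h

theorem leftDifferential_apply (x u : j.NilGroup) :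
    j.leftDifferential x u = u - (1 / 2 : ℝ) • j.bracketL x u := by
  rw [leftDifferential_eq]; rfl

/-- The correction terms of the left differential are central, so brackets do not see them. -/
theorem bracketL_leftDifferential (x u v : j.NilGroup) :
    j.bracketL (j.leftDifferential x u) (j.leftDifferential x v) = j.bracketL u v := by
  simp [leftDifferential_apply, bracketL_left, bracketL_right]

theorem leftDifferential_surjective (x : j.NilGroup) :
    Function.Surjective (j.leftDifferential x) := fun w =>
  ⟨w + (1 / 2 : ℝ) • j.bracketL x w, by
    simp [leftDifferential_apply, bracketL_right]⟩

theorem leftDifferential_zero (u : j.NilGroup) : j.leftDifferential 0 u = u := by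
  simp [leftDifferential_apply]

theorem hasFDerivAt_leftDifferential (x u : j.NilGroup) :
    HasFDerivAt (fun y => j.leftDifferential y u) (-((1 / 2 : ℝ) • j.bracketL.flip u)) x := by
  simp only [leftDifferential_apply]
  exact ((j.bracketL.flip u).hasFDerivAt.const_smul (1 / 2 : ℝ)).const_sub u

theorem metric_val (x u v : j.NilGroup) :
    j.metric.val x u v = ⟪j.leftDifferential x u, j.leftDifferential x v⟫ := rfl

theorem fderiv_metric_val (x u v w : j.NilGroup) :
    fderiv ℝ j.metric.val x u v w =
      -(1 / 2 : ℝ) * (⟪j.bracketL u v, j.leftDifferential x w⟫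
        + ⟪j.bracketL u w, j.leftDifferential x v⟫) := by
  have h1 : HasFDerivAt j.metric.val (fderiv ℝ j.metric.val x) x :=
    (j.metric.smooth.differentiable (by simp)).differentiableAt.hasFDerivAt
  have h2 := ((h1.clm_apply (hasFDerivAt_const v x)).clm_apply (hasFDerivAt_const w x))
  have h3 := (j.hasFDerivAt_leftDifferential x v).inner ℝ (j.hasFDerivAt_leftDifferential x w)
  have h4 := congrArg (fun L => L u) (h2.unique h3)
  simp only [ContinuousLinearMap.comp_zero, zero_add] at h4
  refine Eq.trans ?_ (h4.trans ?_)
  · simp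
  · simp [inner_neg_left, inner_neg_right, inner_smul_left, inner_smul_right]
    rw [real_inner_comm]
    ring

/-- The Levi-Civita product of the metric Lie algebra, given by Koszul's formula. -/
def leviCivita : j.NilGroup →L[ℝ] j.NilGroup →L[ℝ] j.NilGroup :=
  LinearMap.toContinuousBilinearMap (LinearMap.mk₂ ℝ
    (fun u v => (1 / 2 : ℝ) • (j.bracketL u v - (j.bracketL u).adjoint v
      - (j.bracketL v).adjoint u))
    (fun _ _ _ => by simp only [map_add, add_apply]; module)
    (fun _ _ _ => by simp only [map_smul, smul_apply]; module)
    (fun _ _ _ => by simp only [map_add, add_apply]; module)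
    (fun _ _ _ => by simp only [map_smul, smul_apply]; module))

theorem inner_leviCivita (u v w : j.NilGroup) :
    ⟪j.leviCivita u v, w⟫ = (1 / 2 : ℝ) *
      (⟪j.bracketL u v, w⟫ - ⟪j.bracketL u w, v⟫ - ⟪j.bracketL v w, u⟫) := by
  change ⟪(1 / 2 : ℝ) • (j.bracketL u v - (j.bracketL u).adjoint v
      - (j.bracketL v).adjoint u), w⟫ = _
  rw [inner_smul_left, inner_sub_left, inner_sub_left, ContinuousLinearMap.adjoint_inner_left,
    ContinuousLinearMap.adjoint_inner_left, real_inner_comm v, real_inner_comm u]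
  simp

/-- Constant fields of the chart are not left-invariant. The first term compensates for this, being
the derivative in direction `u` of the left-trivialised constant field `v`. -/
theorem leftDifferential_christoffel (x u v : j.NilGroup) :
    j.leftDifferential x (j.metric.christoffel x u v) =
      -((1 / 2 : ℝ) • j.bracketL u v)
        + j.leviCivita (j.leftDifferential x u) (j.leftDifferential x v) := by
  refine ext_inner_right ℝ fun w' => ?_
  obtain ⟨w, rfl⟩ := j.leftDifferential_surjective x w'
  have h := j.metric.christoffel_spec x u v w
  rw [metric_val] at h
  rw [h, fderiv_metric_val, fderiv_metric_val, fderiv_metric_val, inner_add_left, inner_leviCivita,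
    bracketL_leftDifferential, bracketL_leftDifferential, bracketL_leftDifferential,
    inner_neg_left, inner_smul_left, j.bracketL_swap u v, j.bracketL_swap u w,
    j.bracketL_swap v w]
  simp only [inner_neg_left, conj_trivial]
  ring

theorem leftDifferential_nabla (V Y : j.NilGroup → j.NilGroup) (x : j.NilGroup)
    (hY : DifferentiableAt ℝ Y x) :
    j.leftDifferential x (j.metric.nabla V Y x) =
      fderiv ℝ (fun y => j.leftDifferential y (Y y)) x (V x)
        + j.leviCivita (j.leftDifferential x (V x)) (j.leftDifferential x (Y x)) := by
  have h1 : HasFDerivAt (fun y => j.leftDifferential y (Y y))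
      (fderiv ℝ Y x - (1 / 2 : ℝ) • ((j.bracketL x).comp (fderiv ℝ Y x) + j.bracketL.flip (Y x)))
      x := by
    simp only [leftDifferential_apply]
    exact hY.hasFDerivAt.sub ((j.bracketL.hasFDerivAt.clm_apply hY.hasFDerivAt).const_smul (1 / 2 : ℝ))
  rw [h1.fderiv, SmoothMetric.nabla, map_add, leftDifferential_christoffel, ← add_assoc]
  congr 1
  simp [leftDifferential_apply]
  module

theorem leftDifferential_nabla_const (u w : j.NilGroup) (x : j.NilGroup) :
    j.leftDifferential x (j.metric.nabla (fun _ => u) (fun _ => w) x) =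
      -((1 / 2 : ℝ) • j.bracketL u w)
        + j.leviCivita (j.leftDifferential x u) (j.leftDifferential x w) := by
  rw [← leftDifferential_christoffel, SmoothMetric.nabla]
  simp

theorem hasFDerivAt_leviCivita_leftDifferential (x u w : j.NilGroup) :
    HasFDerivAt (fun y => -((1 / 2 : ℝ) • j.bracketL u w)
        + j.leviCivita (j.leftDifferential y u) (j.leftDifferential y w))
      ((j.leviCivita (j.leftDifferential x u)).comp (-((1 / 2 : ℝ) • j.bracketL.flip w))
        + (j.leviCivita.comp (-((1 / 2 : ℝ) • j.bracketL.flip u))).flip (j.leftDifferential x w))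
      x :=
  (((j.leviCivita.hasFDerivAt.comp x (j.hasFDerivAt_leftDifferential x u)).clm_apply
    (j.hasFDerivAt_leftDifferential x w))).const_add _

theorem differentiable_nabla_const (u w : j.NilGroup) :
    Differentiable ℝ (j.metric.nabla (fun _ => u) fun _ => w) := by
  -- The inverse of the left differential at `y` is `id + ½ [y, ·]`, because iterated brackets
  -- vanish.
  have h : j.metric.nabla (fun _ => u) (fun _ => w) = fun y =>
      (-((1 / 2 : ℝ) • j.bracketL u w)
        + j.leviCivita (j.leftDifferential y u) (j.leftDifferential y w))
      + (1 / 2 : ℝ) • j.bracketL y (-((1 / 2 : ℝ) • j.bracketL u w)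
        + j.leviCivita (j.leftDifferential y u) (j.leftDifferential y w)) := by
    funext y
    rw [← leftDifferential_nabla_const]
    simp [leftDifferential_apply, bracketL_right]
  rw [h]
  intro y
  have h1 := (j.hasFDerivAt_leviCivita_leftDifferential y u w).differentiableAt
  exact h1.add ((j.bracketL.differentiableAt.clm_apply h1).const_smul (1 / 2 : ℝ))

/-- The curvature endomorphism of the metric Lie algebra. -/
def algCurvature (u v w : j.NilGroup) : j.NilGroup :=
  j.leviCivita (j.bracketL u v) w + j.leviCivita v (j.leviCivita u w)
    - j.leviCivita u (j.leviCivita v w)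

theorem leftDifferential_curvature (x u v w : j.NilGroup) :
    j.leftDifferential x (j.metric.curvature x u v w) =
      j.algCurvature (j.leftDifferential x u) (j.leftDifferential x v)
        (j.leftDifferential x w) := by
  rw [SmoothMetric.curvature, map_sub,
    leftDifferential_nabla _ _ _ _ (j.differentiable_nabla_const u w x),
    leftDifferential_nabla _ _ _ _ (j.differentiable_nabla_const v w x)]
  simp only [leftDifferential_nabla_const]
  rw [(j.hasFDerivAt_leviCivita_leftDifferential x u w).fderiv,
    (j.hasFDerivAt_leviCivita_leftDifferential x v w).fderiv]
  simp only [algCurvature, bracketL_leftDifferential]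
  simp [j.bracketL_swap u v]
  module

/-- The `(0,4)`-curvature tensor of the metric Lie algebra. -/
def algCurvatureTensor : ContinuousMultilinearMap ℝ (fun _ : Fin (4 + 0) => j.NilGroup) ℝ where
  toMultilinearMap := MultilinearMap.mk' (fun a => ⟪j.algCurvature (a 0) (a 1) (a 2), a 3⟫)
    (by
      intro a i x y
      fin_cases i <;>
        simp [Function.update, algCurvature, inner_add_left, inner_add_right, inner_sub_left] <;>
        ring)
    (by
      intro a i c x
      fin_cases i <;>
        simp [Function.update, algCurvature, inner_add_left, inner_smul_left, inner_smul_right,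
          inner_sub_left] <;>
        ring)
  cont := by
    change Continuous fun a : Fin (4 + 0) → j.NilGroup => ⟪j.algCurvature (a 0) (a 1) (a 2), a 3⟫
    unfold algCurvature
    fun_prop

/-- The covariant derivatives of the curvature tensor of the metric Lie algebra. -/
def algNablaCurvature : (p : ℕ) → ContinuousMultilinearMap ℝ (fun _ : Fin (4 + p) => j.NilGroup) ℝ
  | 0 => j.algCurvatureTensor
  | p + 1 => ContinuousLinearMap.uncurryLeft (-∑ i : Fin (4 + p),
      (((ContinuousMultilinearMap.compContinuousLinearMapContinuousMultilinear ℝ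
        (fun _ : Fin (4 + p) => j.NilGroup) (fun _ => j.NilGroup) ℝ).toContinuousLinearMap
          (fun _ => ContinuousLinearMap.id ℝ _) i).flip (algNablaCurvature p)).comp j.leviCivita)

theorem algNablaCurvature_succ (p : ℕ) (a : Fin (4 + p + 1) → j.NilGroup) :
    j.algNablaCurvature (p + 1) a = -∑ i : Fin (4 + p), j.algNablaCurvature p
      (Function.update (Fin.tail a) i (j.leviCivita (a 0) (Fin.tail a i))) := by
  change (-∑ i : Fin (4 + p),
      (((ContinuousMultilinearMap.compContinuousLinearMapContinuousMultilinear ℝ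
        (fun _ : Fin (4 + p) => j.NilGroup) (fun _ => j.NilGroup) ℝ).toContinuousLinearMap
          (fun _ => ContinuousLinearMap.id ℝ _) i).flip (j.algNablaCurvature p)).comp
            j.leviCivita) (a 0) (Fin.tail a) = _
  simp only [neg_apply, sum_apply]
  congr 1
  refine Finset.sum_congr rfl fun i _ => ?_
  change j.algNablaCurvature p (fun k => (Function.update
    (fun _ => ContinuousLinearMap.id ℝ j.NilGroup) i (j.leviCivita (a 0)) k) (Fin.tail a k)) = _
  congr 1
  funext k
  by_cases h : k = i
  · subst h; simp
  · simp [h]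

theorem nablaCurvature_eq (p : ℕ) (x : j.NilGroup) (a : Fin (4 + p) → j.NilGroup) :
    j.metric.nablaCurvature p x a =
      j.algNablaCurvature p fun i => j.leftDifferential x (a i) := by
  induction p generalizing x with
  | zero =>
    change j.metric.val x (j.metric.curvature x (a 0) (a 1) (a 2)) (a 3) = _
    rw [metric_val, leftDifferential_curvature]
    rfl
  | succ p ih =>
    change j.metric.nablaTensor (j.metric.nablaCurvature p) x a = _
    have hfun : (fun y => j.metric.nablaCurvature p y (Fin.tail a)) = fun y =>
        j.algNablaCurvature p fun i => j.leftDifferential y (Fin.tail a i) :=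
      funext fun y => ih y _
    have hd : HasFDerivAt (fun y => j.algNablaCurvature p
        fun i => j.leftDifferential y (Fin.tail a i))
        (((j.algNablaCurvature p).linearDeriv fun i => j.leftDifferential x (Fin.tail a i)).comp
          (ContinuousLinearMap.pi fun i => -((1 / 2 : ℝ) • j.bracketL.flip (Fin.tail a i)))) x :=
      ((j.algNablaCurvature p).hasFDerivAt _).comp x
        (hasFDerivAt_pi.mpr fun i => j.hasFDerivAt_leftDifferential x (Fin.tail a i))
    rw [SmoothMetric.nablaTensor, hfun, hd.fderiv, algNablaCurvature_succ]
    simp only [ContinuousLinearMap.comp_apply, ContinuousMultilinearMap.linearDeriv_apply]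
    rw [← Finset.sum_sub_distrib, ← Finset.sum_neg_distrib]
    refine Finset.sum_congr rfl fun i _ => ?_
    have hup : (fun k => j.leftDifferential x (Function.update (Fin.tail a) i
        (j.metric.christoffel x (a 0) (Fin.tail a i)) k)) =
        Function.update (fun k => j.leftDifferential x (Fin.tail a k)) i
          (j.leftDifferential x (j.metric.christoffel x (a 0) (Fin.tail a i))) := by
      funext k
      by_cases h : k = i
      · subst h; simp
      · simp [h]
    rw [ih]
    refine (congrArg₂ (· - ·) rfl (congrArg (j.algNablaCurvature p) hup)).trans ?_
    rw [leftDifferential_christoffel, ContinuousMultilinearMap.map_update_add]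
    simp only [ContinuousLinearMap.pi_apply, neg_apply, smul_apply, ContinuousLinearMap.flip_apply]
    -- The derivative of the left differential cancels the `-½ [a₀, aᵢ]` part of the Christoffel
    -- symbol, leaving minus the Levi-Civita term.
    exact sub_add_cancel_left _ _

end JMap

/-! ### Curvature components as polynomials in the structure constants -/

/-! ### Replacing a functional by an invariant tensor -/

section InvariantProjection
open Matrix
variable {S ι : Type*} [Fintype S] [DecidableEq S] [Fintype ι] [DecidableEq ι]

/-- The vector `w` is the orthogonal projection of `p` to `U`; it exists because the dot product is
nondegenerate on `U`. -/
theorem exists_dotProduct_eq_of_submodule {κ : Type*} [Fintype κ] (U : Submodule ℝ (κ → ℝ))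
    (p : κ → ℝ) : ∃ w ∈ U, ∀ u ∈ U, w ⬝ᵥ u = p ⬝ᵥ u := by
  let B : (κ → ℝ) →ₗ[ℝ] Module.Dual ℝ U := LinearMap.mk₂ ℝ (fun w (u : U) => w ⬝ᵥ (u : κ → ℝ))
    (fun _ _ _ => add_dotProduct _ _ _) (fun _ _ _ => smul_dotProduct _ _ _)
    (fun _ _ _ => dotProduct_add _ _ _) (fun _ _ _ => dotProduct_smul _ _ _)
  have hinj : Function.Injective (B.comp U.subtype) := by
    rw [← LinearMap.ker_eq_bot, LinearMap.ker_eq_bot']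
    intro u hu
    have h : (u : κ → ℝ) ⬝ᵥ (u : κ → ℝ) = 0 := congrArg (fun f => f u) hu
    exact Subtype.ext (dotProduct_self_eq_zero.mp h)
  have hsurj := (LinearMap.injective_iff_surjective_of_finrank_eq_finrank
    (Subspace.dual_finrank_eq (K := ℝ) (V := U)).symm).mp hinj
  obtain ⟨w, hw⟩ := hsurj (B p)
  exact ⟨w, w.2, fun u hu => congrArg (fun f => f ⟨u, hu⟩) hw⟩

/-- A linear functional which is invariant on an orthogonally stable set of tensors agrees there
with an invariant tensor. -/
theorem exists_orthogonalInvariant_dotProduct_eq (X : Set ((S → ι) → ℝ)) (p : (S → ι) → ℝ)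
    (hX : ∀ A : Matrix ι ι ℝ, A * Aᵀ = 1 → ∀ u ∈ X, tensorPower S A *ᵥ u ∈ X)
    (hp : ∀ A : Matrix ι ι ℝ, A * Aᵀ = 1 → ∀ u ∈ X, p ⬝ᵥ (tensorPower S A *ᵥ u) = p ⬝ᵥ u) :
    ∃ w ∈ orthogonalInvariants S ι, ∀ u ∈ X, w ⬝ᵥ u = p ⬝ᵥ u := by
  -- Invariance of `p` is known only against `X`, so `p` itself need not be an invariant tensor. Its
  -- projection to the span of `X` is one, and no averaging over the group is needed.
  obtain ⟨w, hwU, hw⟩ := exists_dotProduct_eq_of_submodule (Submodule.span ℝ X) p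
  refine ⟨w, fun A hA => ?_, fun u hu => hw u (Submodule.subset_span hu)⟩
  have hstab : ∀ A : Matrix ι ι ℝ, A * Aᵀ = 1 → ∀ u ∈ Submodule.span ℝ X,
      tensorPower S A *ᵥ u ∈ Submodule.span ℝ X := by
    intro A hA u hu
    have : Submodule.span ℝ X ≤ (Submodule.span ℝ X).comap (tensorPower S A).mulVecLin :=
      Submodule.span_le.mpr fun u hu => Submodule.subset_span (hX A hA u hu)
    exact this hu
  have hinv : ∀ A : Matrix ι ι ℝ, A * Aᵀ = 1 → ∀ u ∈ Submodule.span ℝ X,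
      p ⬝ᵥ (tensorPower S A *ᵥ u) = p ⬝ᵥ u := by
    intro A hA u hu
    induction hu using Submodule.span_induction with
    | mem u hu => exact hp A hA u hu
    | zero => simp
    | add u v _ _ hu hv => rw [mulVec_add, dotProduct_add, dotProduct_add, hu, hv]
    | smul c u _ hu => rw [mulVec_smul, dotProduct_smul, dotProduct_smul, hu]
  have hAt : Aᵀ * Aᵀᵀ = 1 := by rw [transpose_transpose]; exact mul_eq_one_comm.mp hA
  have hz : tensorPower S A *ᵥ w - w ∈ Submodule.span ℝ X :=
    Submodule.sub_mem _ (hstab A hA w hwU) hwU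
  -- The difference `z` lies in the span, and moving `A` across the dot product shows that `A w` and
  -- `w` have the same product with `z`. Hence `z ⬝ᵥ z = 0`.
  refine sub_eq_zero.mp (dotProduct_self_eq_zero.mp ?_)
  generalize hzdef : tensorPower S A *ᵥ w - w = z at hz
  have h1 : (tensorPower S A *ᵥ w) ⬝ᵥ z = w ⬝ᵥ (tensorPower S Aᵀ *ᵥ z) := by
    rw [tensorPower_transpose, dotProduct_mulVec, vecMul_transpose]
  nth_rewrite 1 [← hzdef]
  rw [sub_dotProduct, h1, hw _ (hstab _ hAt z hz), hinv _ hAt z hz, hw z hz, sub_self]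

end InvariantProjection

/-! ### Homogeneous polynomials as tensors -/

section Homogeneous
open MvPolynomial

theorem exists_tensor_of_isHomogeneous {σ : Type*} [Fintype σ] [DecidableEq σ]
    {Q : MvPolynomial σ ℝ} {d : ℕ} (hQ : Q.IsHomogeneous d) :
    ∃ p : (Fin d → σ) → ℝ, ∀ D : σ → ℝ, eval D Q = ∑ i, p i * ∏ t, D (i t) := by
  have hmon : ∀ m ∈ Q.support, ∃ i : Fin d → σ, ∀ D : σ → ℝ,
      ∏ s ∈ m.support, D s ^ m s = ∏ t, D (i t) := by
    intro m hm
    have hdeg : m.toMultiset.toList.length = d := by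
      rw [Multiset.length_toList, Finsupp.card_toMultiset]
      have := hQ (mem_support_iff.mp hm)
      rw [Finsupp.weight_apply] at this
      simp only [Pi.one_apply, smul_eq_mul, mul_one] at this
      exact this
    -- List the variables of the monomial with multiplicity in any order; the resulting coefficient
    -- tensor need not be symmetric.
    refine ⟨fun t => m.toMultiset.toList.get (t.cast hdeg.symm), fun D => ?_⟩
    have h1 : ∏ s ∈ m.support, D s ^ m s = (m.toMultiset.map D).prod := by
      rw [Finsupp.toMultiset_map, Finsupp.prod_toMultiset, Finsupp.prod_mapDomain_index] <;>
        simp [Finsupp.prod, pow_add]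
    have h2 : (m.toMultiset.map D).prod = (m.toMultiset.toList.map D).prod := by
      rw [← Multiset.prod_coe, ← Multiset.map_coe, Multiset.coe_toList]
    rw [h1, h2]
    subst hdeg
    rw [← List.prod_ofFn]
    congr 1
    refine List.ext_get (by simp) fun k _ _ => by simp
  choose I hI using hmon
  refine ⟨fun i => ∑ m ∈ Q.support.attach, if I m.1 m.2 = i then coeff m.1 Q else 0, fun D => ?_⟩
  rw [eval_eq, ← Finset.sum_attach]
  simp only [Finset.sum_mul]
  rw [Finset.sum_comm]
  refine Finset.sum_congr rfl fun m _ => ?_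
  rw [hI m.1 m.2]
  simp

theorem isHomogeneous_bind₁_of_isWeightedHomogeneous {σ τ : Type*} {w : σ → ℕ}
    {P : MvPolynomial σ ℝ} {d : ℕ} (hP : IsWeightedHomogeneous w P d)
    {f : σ → MvPolynomial τ ℝ} (hf : ∀ s, (f s).IsHomogeneous (w s)) :
    (bind₁ f P).IsHomogeneous d := by
  have h : bind₁ f P = ∑ m ∈ P.support, C (coeff m P) * ∏ s ∈ m.support, f s ^ m s := by
    rw [bind₁, aeval_def, eval₂_eq]
    rfl
  rw [h]
  refine IsHomogeneous.sum _ _ _ fun m hm => ?_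
  have hd : d = 0 + ∑ s ∈ m.support, w s * m s := by
    rw [← hP (mem_support_iff.mp hm), Finsupp.weight_apply, Finsupp.sum, zero_add]
    simp [mul_comm]
  rw [hd]
  exact (isHomogeneous_C _ _).mul (IsHomogeneous.prod _ _ _ fun s _ => (hf s).pow _)

end Homogeneous

section Polynomials
open MvPolynomial
variable {ι : Type*} [Fintype ι] [DecidableEq ι]

/-- The components of the Levi-Civita product as polynomials in the structure constants. -/
def leviCivitaPoly (a b c : ι) : MvPolynomial (Fin 3 → ι) ℝ :=
  C (1 / 2) * (X ![a, b, c] - X ![a, c, b] - X ![b, c, a])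

/-- The components of the curvature tensor as polynomials in the structure constants. -/
def curvaturePoly (i : Fin (4 + 0) → ι) : MvPolynomial (Fin 3 → ι) ℝ :=
  ∑ c, (X ![i 0, i 1, c] * leviCivitaPoly c (i 2) (i 3)
    + leviCivitaPoly (i 0) (i 2) c * leviCivitaPoly (i 1) c (i 3)
    - leviCivitaPoly (i 1) (i 2) c * leviCivitaPoly (i 0) c (i 3))

/-- The components of the covariant derivatives of the curvature tensor as polynomials in the
structure constants. -/
def nablaCurvaturePoly : (p : ℕ) → (Fin (4 + p) → ι) → MvPolynomial (Fin 3 → ι) ℝ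
  | 0 => curvaturePoly
  | p + 1 => fun i => -∑ s : Fin (4 + p), ∑ c, leviCivitaPoly (i 0) (Fin.tail i s) c *
      nablaCurvaturePoly p (Function.update (Fin.tail i) s c)

theorem isHomogeneous_leviCivitaPoly (a b c : ι) : (leviCivitaPoly a b c).IsHomogeneous 1 := by
  have h := (isHomogeneous_C (Fin 3 → ι) (1 / 2 : ℝ)).mul
    (((isHomogeneous_X ℝ ![a, b, c]).sub (isHomogeneous_X ℝ ![a, c, b])).sub
      (isHomogeneous_X ℝ ![b, c, a]))
  exact h

/-- The curvature is quadratic in the structure constants and each covariant derivative adds one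
linear factor. The degree therefore equals `CurvatureVar.order`. -/
theorem isHomogeneous_nablaCurvaturePoly (p : ℕ) (i : Fin (4 + p) → ι) :
    (nablaCurvaturePoly p i).IsHomogeneous (p + 2) := by
  induction p with
  | zero =>
    refine IsHomogeneous.sum _ _ _ fun c _ => IsHomogeneous.sub (IsHomogeneous.add ?_ ?_) ?_
    · exact (isHomogeneous_X ℝ _).mul (isHomogeneous_leviCivitaPoly _ _ _)
    · exact (isHomogeneous_leviCivitaPoly _ _ _).mul (isHomogeneous_leviCivitaPoly _ _ _)
    · exact (isHomogeneous_leviCivitaPoly _ _ _).mul (isHomogeneous_leviCivitaPoly _ _ _)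
  | succ p ih =>
    refine IsHomogeneous.neg (IsHomogeneous.sum _ _ _ fun s _ => IsHomogeneous.sum _ _ _ fun c _ => ?_)
    have h := (isHomogeneous_leviCivitaPoly (i 0) (Fin.tail i s) c).mul
      (ih (Function.update (Fin.tail i) s c))
    rwa [show 1 + (p + 2) = p + 1 + 2 by ring] at h

/-- The polynomial in the structure constants which expresses a polynomial in the components of the
covariant derivatives of the curvature tensor. -/
def structureConstPoly {n : ℕ} (P : MvPolynomial (CurvatureVar n) ℝ) :
    MvPolynomial (Fin 3 → Fin n) ℝ :=
  MvPolynomial.bind₁ (fun s : CurvatureVar n => nablaCurvaturePoly s.1 s.2) P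

end Polynomials

namespace JMap
open MvPolynomial
variable {m r : ℕ} (j : JMap m r) {ι : Type*} [Fintype ι] [DecidableEq ι]

/-- The trilinear form `⟨[u, v], w⟩` on the metric Lie algebra. -/
def bracketForm : MultilinearMap ℝ (fun _ : Fin 3 => j.NilGroup) ℝ :=
  MultilinearMap.mk' (fun a => ⟪j.bracketL (a 0) (a 1), a 2⟫)
    (by
      intro a i x y
      fin_cases i <;> simp [Function.update, inner_add_left, inner_add_right])
    (by
      intro a i c x
      fin_cases i <;> simp [Function.update, inner_smul_left, inner_smul_right])

theorem bracketForm_apply (a : Fin 3 → j.NilGroup) :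
    j.bracketForm a = ⟪j.bracketL (a 0) (a 1), a 2⟫ := rfl

/-- The structure constants with respect to an orthonormal basis. -/
def structureConst (b : OrthonormalBasis ι ℝ j.NilGroup) (v : Fin 3 → ι) : ℝ :=
  j.bracketForm fun t => b (v t)

variable (b : OrthonormalBasis ι ℝ j.NilGroup)

theorem eval_leviCivitaPoly (x y z : ι) :
    eval (j.structureConst b) (leviCivitaPoly x y z) = ⟪j.leviCivita (b x) (b y), b z⟫ := by
  rw [inner_leviCivita]
  simp [leviCivitaPoly, structureConst, bracketForm_apply]

theorem leviCivita_eq_sum (x y : ι) :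
    j.leviCivita (b x) (b y) =
      ∑ c, eval (j.structureConst b) (leviCivitaPoly x y c) • b c := by
  simp only [eval_leviCivitaPoly]
  conv_lhs => rw [← b.sum_repr' (j.leviCivita (b x) (b y))]
  simp only [real_inner_comm]

theorem bracketL_eq_sum (x y : ι) :
    j.bracketL (b x) (b y) = ∑ c, j.structureConst b ![x, y, c] • b c := by
  conv_lhs => rw [← b.sum_repr' (j.bracketL (b x) (b y))]
  simp [structureConst, bracketForm_apply, real_inner_comm]

theorem eval_nablaCurvaturePoly (p : ℕ) (i : Fin (4 + p) → ι) :
    eval (j.structureConst b) (nablaCurvaturePoly p i) =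
      j.algNablaCurvature p fun s => b (i s) := by
  induction p with
  | zero =>
    change _ = ⟪j.algCurvature (b (i 0)) (b (i 1)) (b (i 2)), b (i 3)⟫
    rw [algCurvature, bracketL_eq_sum, j.leviCivita_eq_sum b (i 0) (i 2),
      j.leviCivita_eq_sum b (i 1) (i 2)]
    simp only [map_sum, map_smul, sum_apply, smul_apply, inner_add_left, inner_sub_left, sum_inner,
      inner_smul_left, ← eval_leviCivitaPoly, conj_trivial, nablaCurvaturePoly, curvaturePoly,
      map_add, map_sub, map_mul, eval_X, Finset.sum_add_distrib, Finset.sum_sub_distrib]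
  | succ p ih =>
    refine Eq.trans ?_ (j.algNablaCurvature_succ p fun s => b (i s)).symm
    simp only [nablaCurvaturePoly, map_neg, map_sum, map_mul, ih]
    congr 1
    refine Finset.sum_congr rfl fun s _ => ?_
    have h : j.leviCivita (b (i 0)) (Fin.tail (fun s => b (i s)) s) =
        ∑ c, eval (j.structureConst b) (leviCivitaPoly (i 0) (Fin.tail i s) c) • b c :=
      j.leviCivita_eq_sum b _ _
    refine Eq.trans ?_ (congrArg (fun y => j.algNablaCurvature p
      (Function.update (Fin.tail fun s => b (i s)) s y)) h).symm
    refine Eq.trans ?_ (map_sum ((j.algNablaCurvature p).toLinearMap _ s) _ _).symm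
    refine Finset.sum_congr rfl fun c _ => ?_
    rw [map_smul, smul_eq_mul]
    congr 1
    change _ = j.algNablaCurvature p (Function.update _ s (b c))
    congr 1
    funext k
    by_cases h : k = s
    · subst h; simp
    · simp [h, Fin.tail]

end JMap

/-! ### Contractions of skew-symmetric matrices as products of traces -/

section Cycles
open Matrix

variable {τ T E : Type} [Fintype T] [DecidableEq T] [Fintype E] [DecidableEq E]

/-- The contraction of matrix words `W t`, whose row and column indices are labelled by `s₀ t` and
`s₁ t`, is a multiple of a product of traces of words, for all skew-symmetric matrices. -/
def IsTraceProduct (s₀ s₁ : T → E) (W : T → List τ) : Prop :=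
  ∃ (ε : ℝ) (L : List (List τ)), (∀ w ∈ L, w ≠ []) ∧
    (L.flatten : Multiset τ) = ∑ t, (W t : Multiset τ) ∧
    ∀ (κ : Type) [Fintype κ] [DecidableEq κ] (M : τ → Matrix κ κ ℝ), (∀ t, (M t)ᵀ = -M t) →
      ∑ a : E → κ, ∏ t, ((W t).map M).prod (a (s₀ t)) (a (s₁ t)) =
        ε * (L.map fun w => ((w.map M).prod).trace).prod

theorem transpose_prod_of_skew {κ : Type} [Fintype κ] [DecidableEq κ] (M : τ → Matrix κ κ ℝ)
    (hM : ∀ t, (M t)ᵀ = -M t) (w : List τ) :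
    ((w.map M).prod)ᵀ = (-1 : ℝ) ^ w.length • (w.reverse.map M).prod := by
  induction w with
  | nil => simp
  | cons x w ih =>
    simp [transpose_mul, hM, ih, pow_succ]

/-- Reversing one edge of the graph: the transposed word is the reversed word up to a sign that
depends only on its length. -/
theorem IsTraceProduct.of_flip {s₀ s₁ : T → E} {W : T → List τ} (t₀ : T)
    (h : IsTraceProduct (Function.update s₀ t₀ (s₁ t₀)) (Function.update s₁ t₀ (s₀ t₀))
      (Function.update W t₀ (W t₀).reverse)) : IsTraceProduct s₀ s₁ W := by
  obtain ⟨ε, L, hL, hm, h⟩ := h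
  refine ⟨(-1) ^ (W t₀).length * ε, L, hL, ?_, fun κ _ _ M hM => ?_⟩
  · rw [hm]
    refine Finset.sum_congr rfl fun t _ => ?_
    by_cases ht : t = t₀
    · subst ht; simp
    · simp [ht]
  · rw [mul_assoc, ← h κ M hM, Finset.mul_sum]
    refine Finset.sum_congr rfl fun a _ => ?_
    rw [← Finset.mul_prod_erase _ _ (Finset.mem_univ t₀),
      ← Finset.mul_prod_erase _ _ (Finset.mem_univ t₀), ← mul_assoc]
    congr 1
    · simp only [Function.update_self]
      have h2 := congrFun (congrFun (transpose_prod_of_skew M hM (W t₀)) (a (s₁ t₀))) (a (s₀ t₀))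
      simpa using h2
    · refine Finset.prod_congr rfl fun t ht => ?_
      simp [(Finset.mem_erase.mp ht).1]

/-- The number of index slots with the label `e`. -/
def labelDegree (s₀ s₁ : T → E) (e : E) : ℕ :=
  (∑ t, if s₀ t = e then 1 else 0) + ∑ t, if s₁ t = e then 1 else 0

theorem labelDegree_flip (s₀ s₁ : T → E) (t₀ : T) (e : E) :
    labelDegree (Function.update s₀ t₀ (s₁ t₀)) (Function.update s₁ t₀ (s₀ t₀)) e =
      labelDegree s₀ s₁ e := by
  unfold labelDegree
  rw [← Finset.sum_add_distrib, ← Finset.sum_add_distrib]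
  refine Finset.sum_congr rfl fun t _ => ?_
  by_cases ht : t = t₀
  · subst ht; simp [add_comm]
  · simp [ht]

theorem sum_fun_eq_sum_funSplitAt {κ : Type} [Fintype κ] (e₀ : E) (F : (E → κ) → ℝ) :
    ∑ a, F a = ∑ a : {e // e ≠ e₀} → κ, ∑ x, F ((Equiv.funSplitAt e₀ κ).symm (x, a)) := by
  rw [← (Equiv.funSplitAt e₀ κ).symm.sum_comp, Fintype.sum_prod_type, Finset.sum_comm]

theorem sum_eq_add_sum_subtype_ne (f : T → ℕ) (t : T) :
    ∑ u, f u = f t + ∑ u : {u // u ≠ t}, f u :=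
  Fintype.sum_eq_add_sum_subtype_ne f t

/-- When both ends of a word carry `e₀` and no other end does, summing over that label splits off
the trace of the word. -/
theorem isTraceProduct_of_loop {s₀ s₁ : T → E} {W : T → List τ} (hW : ∀ t, W t ≠ []) {t₀ : T}
    {e₀ : E} (h₀ : s₀ t₀ = e₀) (h₁ : s₁ t₀ = e₀) (hne₀ : ∀ t, t ≠ t₀ → s₀ t ≠ e₀)
    (hne₁ : ∀ t, t ≠ t₀ → s₁ t ≠ e₀)
    (h : IsTraceProduct (T := {t // t ≠ t₀}) (E := {e // e ≠ e₀}) (fun t => ⟨s₀ t, hne₀ t t.2⟩)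
      (fun t => ⟨s₁ t, hne₁ t t.2⟩) fun t => W t) : IsTraceProduct s₀ s₁ W := by
  obtain ⟨ε, L, hL, hm, h⟩ := h
  refine ⟨ε, W t₀ :: L, ?_, ?_, fun κ _ _ M hM => ?_⟩
  · intro w hw
    rcases List.mem_cons.mp hw with rfl | hw
    · exact hW t₀
    · exact hL w hw
  · rw [List.flatten_cons, ← Multiset.coe_add, hm, Fintype.sum_eq_add_sum_subtype_ne _ t₀]
  · rw [sum_fun_eq_sum_funSplitAt e₀, List.map_cons, List.prod_cons, mul_left_comm, ← h κ M hM,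
      Finset.mul_sum]
    refine Finset.sum_congr rfl fun a _ => ?_
    rw [Matrix.trace, Finset.sum_mul]
    refine Finset.sum_congr rfl fun x _ => ?_
    rw [Fintype.prod_eq_mul_prod_subtype_ne _ t₀]
    congr 1
    · simp [h₀, h₁, Equiv.funSplitAt, Equiv.piSplitAt]
    · refine Finset.prod_congr rfl fun t _ => ?_
      simp [Equiv.funSplitAt, Equiv.piSplitAt, hne₀ t t.2, hne₁ t t.2]

/-- Summing over a label shared by the end of one word and the start of another is matrix
multiplication, so the two edges become one with the concatenated word. -/
theorem isTraceProduct_of_merge {s₀ s₁ : T → E} {W : T → List τ} {t₁ t₂ : T} (h12 : t₁ ≠ t₂)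
    {e₀ : E} (h₁ : s₁ t₁ = e₀) (h₂ : s₀ t₂ = e₀) (hne₀ : ∀ t, t ≠ t₂ → s₀ t ≠ e₀)
    (hne₁ : ∀ t, t ≠ t₁ → s₁ t ≠ e₀)
    (h : IsTraceProduct (T := {t // t ≠ t₂}) (E := {e // e ≠ e₀}) (fun t => ⟨s₀ t, hne₀ t t.2⟩)
      (fun t => if ht : t = t₁ then ⟨s₁ t₂, hne₁ t₂ h12.symm⟩ else ⟨s₁ t, hne₁ t ht⟩)
      fun t => if t = t₁ then W t₁ ++ W t₂ else W t) : IsTraceProduct s₀ s₁ W := by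
  obtain ⟨ε, L, hL, hm, h⟩ := h
  refine ⟨ε, L, hL, ?_, fun κ _ _ M hM => ?_⟩
  · rw [hm, Fintype.sum_eq_add_sum_subtype_ne (fun t => (W t : Multiset τ)) t₂,
      Fintype.sum_eq_add_sum_subtype_ne _ (⟨t₁, h12⟩ : {t // t ≠ t₂}),
      Fintype.sum_eq_add_sum_subtype_ne _ (⟨t₁, h12⟩ : {t // t ≠ t₂}), ← add_assoc]
    congr 1
    · simp [← Multiset.coe_add, add_comm]
    · refine Finset.sum_congr rfl fun t _ => ?_
      have : (t : T) ≠ t₁ := fun h => t.2 (Subtype.ext h)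
      simp [this]
  · rw [sum_fun_eq_sum_funSplitAt e₀, ← h κ M hM]
    refine Finset.sum_congr rfl fun a _ => ?_
    rw [Fintype.prod_eq_mul_prod_subtype_ne _ (⟨t₁, h12⟩ : {t // t ≠ t₂})]
    simp only [if_true, dif_pos, List.map_append, List.prod_append, Matrix.mul_apply,
      Finset.sum_mul]
    refine Finset.sum_congr rfl fun x _ => ?_
    rw [Fintype.prod_eq_mul_prod_subtype_ne _ t₂,
      Fintype.prod_eq_mul_prod_subtype_ne _ (⟨t₁, h12⟩ : {t // t ≠ t₂}), ← mul_assoc,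
      mul_comm (((W t₂).map M).prod _ _)]
    congr 1
    · simp [Equiv.funSplitAt, Equiv.piSplitAt, h₁, h₂, hne₀ t₁ h12, hne₁ t₂ h12.symm]
    · refine Finset.prod_congr rfl fun t _ => ?_
      have : (t : T) ≠ t₁ := fun h => t.2 (Subtype.ext h)
      simp [Equiv.funSplitAt, Equiv.piSplitAt, this, hne₀ t t.1.2, hne₁ t this]

/-- The two given slots exhaust the degree. A loop, `t₁ = t₂`, is allowed since its ends count
separately. -/
theorem ne_of_labelDegree {s₀ s₁ : T → E} {e : E} {t₁ t₂ : T}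
    (h : labelDegree s₀ s₁ e = 2) (h₁ : s₁ t₁ = e) (h₂ : s₀ t₂ = e) :
    (∀ t, t ≠ t₂ → s₀ t ≠ e) ∧ ∀ t, t ≠ t₁ → s₁ t ≠ e := by
  unfold labelDegree at h
  rw [sum_eq_add_sum_subtype_ne _ t₂, sum_eq_add_sum_subtype_ne (fun t => if s₁ t = e then 1 else 0)
    t₁, if_pos h₂, if_pos h₁] at h
  have ha : ∑ u : {u // u ≠ t₂}, (if s₀ u = e then 1 else 0) = 0 := by omega
  have hb : ∑ u : {u // u ≠ t₁}, (if s₁ u = e then 1 else 0) = 0 := by omega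
  rw [Finset.sum_eq_zero_iff] at ha hb
  refine ⟨fun t ht h => ?_, fun t ht h => ?_⟩
  · simpa [h] using ha ⟨t, ht⟩ (Finset.mem_univ _)
  · simpa [h] using hb ⟨t, ht⟩ (Finset.mem_univ _)

theorem exists_ne_of_labelDegree {s₀ s₁ : T → E} {e : E} {t₁ : T}
    (h : labelDegree s₀ s₁ e = 2) (h₀ : s₀ t₁ ≠ e) : ∃ t₂, t₂ ≠ t₁ ∧ (s₀ t₂ = e ∨ s₁ t₂ = e) := by
  by_contra! hc
  unfold labelDegree at h
  rw [sum_eq_add_sum_subtype_ne _ t₁, sum_eq_add_sum_subtype_ne (fun t => if s₁ t = e then 1 else 0)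
    t₁, Finset.sum_eq_zero (fun u _ => if_neg (hc u.1 u.2).1),
    Finset.sum_eq_zero (fun u _ => if_neg (hc u.1 u.2).2), if_neg h₀] at h
  split_ifs at h
  simp at h

/-- A finite graph with all degrees two is a union of cycles. Induction on the number of vertices: a
chosen vertex `e₀` either carries a loop, which becomes a trace, or joins two edges, which are
merged after flipping one if necessary. Both operations preserve the degrees of the other vertices.
-/
theorem isTraceProduct_of_labelDegree (N : ℕ) : ∀ (T E : Type) [Fintype T] [DecidableEq T]
    [Fintype E] [DecidableEq E], Fintype.card E = N → ∀ (s₀ s₁ : T → E) (W : T → List τ),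
    (∀ t, W t ≠ []) → (∀ e, labelDegree s₀ s₁ e = 2) → IsTraceProduct s₀ s₁ W := by
  induction N with
  | zero =>
    intro T E _ _ _ _ hE s₀ s₁ W hW hdeg
    have hEe : IsEmpty E := Fintype.card_eq_zero_iff.mp hE
    have hTe : IsEmpty T := ⟨fun t => hEe.elim (s₀ t)⟩
    exact ⟨1, [], by simp, by simp, by simp⟩
  | succ N ih =>
    intro T E _ _ _ _ hE
    have hcard : ∀ e₀ : E, Fintype.card {e // e ≠ e₀} = N := by
      intro e₀
      rw [Fintype.card_subtype_compl, hE]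
      simp
    obtain ⟨e₀⟩ : Nonempty E := Fintype.card_pos_iff.mp (by omega)
    have merge : ∀ (s₀ s₁ : T → E) (W : T → List τ), (∀ t, W t ≠ []) →
        (∀ e, labelDegree s₀ s₁ e = 2) → ∀ t₁ t₂, t₁ ≠ t₂ → s₁ t₁ = e₀ → s₀ t₂ = e₀ →
        IsTraceProduct s₀ s₁ W := by
      intro s₀ s₁ W hW hdeg t₁ t₂ h12 h₁ h₂
      obtain ⟨hne₀, hne₁⟩ := ne_of_labelDegree (hdeg e₀) h₁ h₂
      refine isTraceProduct_of_merge h12 h₁ h₂ hne₀ hne₁ (ih _ _ (hcard e₀) _ _ _ ?_ ?_)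
      · intro t
        split_ifs
        · simp [hW]
        · exact hW _
      · rintro ⟨e, he⟩
        rw [← hdeg e]
        unfold labelDegree
        rw [sum_eq_add_sum_subtype_ne (fun t => if s₀ t = e then 1 else 0) t₂,
          sum_eq_add_sum_subtype_ne (fun t => if s₁ t = e then 1 else 0) t₂,
          sum_eq_add_sum_subtype_ne _ (⟨t₁, h12⟩ : {t // t ≠ t₂}),
          sum_eq_add_sum_subtype_ne _ (⟨t₁, h12⟩ : {t // t ≠ t₂}),
          sum_eq_add_sum_subtype_ne _ (⟨t₁, h12⟩ : {t // t ≠ t₂}),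
          sum_eq_add_sum_subtype_ne _ (⟨t₁, h12⟩ : {t // t ≠ t₂})]
        have hr : ∀ u : {u : {t // t ≠ t₂} // u ≠ ⟨t₁, h12⟩}, ((u : {t // t ≠ t₂}) : T) ≠ t₁ :=
          fun u h => u.2 (Subtype.ext h)
        have hs : ∀ u : {u : {t // t ≠ t₂} // u ≠ ⟨t₁, h12⟩},
            (if (if ht : (u : {t // t ≠ t₂}).1 = t₁ then
                (⟨s₁ t₂, hne₁ t₂ h12.symm⟩ : {e // e ≠ e₀}) else ⟨s₁ u, hne₁ u ht⟩) = ⟨e, he⟩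
              then 1 else 0) = if s₁ u = e then 1 else 0 := fun u => by
          rw [dif_neg (hr u)]; simp
        rw [Finset.sum_congr rfl fun u _ => hs u]
        simp only [Subtype.mk.injEq, h₂, h₁, he.symm, if_false, dif_pos]
        omega
    have cut : ∀ (s₀ s₁ : T → E) (W : T → List τ), (∀ t, W t ≠ []) →
        (∀ e, labelDegree s₀ s₁ e = 2) → ∀ t₁, s₁ t₁ = e₀ → IsTraceProduct s₀ s₁ W := by
      intro s₀ s₁ W hW hdeg t₁ h₁
      by_cases h₀ : s₀ t₁ = e₀
      · obtain ⟨hne₀, hne₁⟩ := ne_of_labelDegree (hdeg e₀) h₁ h₀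
        refine isTraceProduct_of_loop hW h₀ h₁ hne₀ hne₁
          (ih _ _ (hcard e₀) _ _ _ (fun t => hW t) ?_)
        rintro ⟨e, he⟩
        rw [← hdeg e]
        unfold labelDegree
        rw [sum_eq_add_sum_subtype_ne (fun t => if s₀ t = e then 1 else 0) t₁,
          sum_eq_add_sum_subtype_ne (fun t => if s₁ t = e then 1 else 0) t₁]
        simp [h₀, h₁, he.symm]
      · obtain ⟨t₂, h21, h₂⟩ := exists_ne_of_labelDegree (hdeg e₀) h₀
        rcases h₂ with h₂ | h₂
        · exact merge s₀ s₁ W hW hdeg t₁ t₂ h21.symm h₁ h₂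
        · refine IsTraceProduct.of_flip t₂ (merge _ _ _ ?_ (fun e => ?_) t₁ t₂ h21.symm ?_ ?_)
          · intro t
            by_cases ht : t = t₂
            · subst ht; simp [hW]
            · simp [ht, hW]
          · rw [labelDegree_flip, hdeg]
          · simp [h21.symm, h₁]
          · simp [h₂]
    intro s₀ s₁ W hW hdeg
    obtain ⟨t, ht⟩ : ∃ t, s₀ t = e₀ ∨ s₁ t = e₀ := by
      by_contra! hc
      have h := hdeg e₀
      unfold labelDegree at h
      simp [hc] at h
    rcases ht with ht | ht
    · refine IsTraceProduct.of_flip t (cut _ _ _ ?_ (fun e => ?_) t ?_)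
      · intro t'
        by_cases ht' : t' = t
        · subst ht'; simp [hW]
        · simp [ht', hW]
      · rw [labelDegree_flip, hdeg]
      · simp [ht]
    · exact cut s₀ s₁ W hW hdeg t ht

end Cycles

/-! ### Curvature invariants as contractions of the structure constants -/

section TensorMonomial
open Matrix
variable {ι : Type*} [Fintype ι] [DecidableEq ι]

/-- The `d`-th tensor power of a tensor with three slots. -/
def tensorMonomial (d : ℕ) (D : (Fin 3 → ι) → ℝ) (i : Fin d × Fin 3 → ι) : ℝ :=
  ∏ t, D fun s => i (t, s)

theorem tensorPower_mulVec_tensorMonomial (d : ℕ) (A : Matrix ι ι ℝ) (D : (Fin 3 → ι) → ℝ) :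
    tensorPower (Fin d × Fin 3) A *ᵥ tensorMonomial d D =
      tensorMonomial d (tensorPower (Fin 3) A *ᵥ D) := by
  funext i
  simp only [mulVec, dotProduct, tensorMonomial, tensorPower, of_apply, Finset.prod_univ_sum,
    Fintype.piFinset_univ, Fintype.prod_prod_type, ← Finset.prod_mul_distrib]
  exact Fintype.sum_equiv (Equiv.curry _ _ _) _ _ fun k => rfl

theorem exists_tensorMonomial_dotProduct {d : ℕ} {Q : MvPolynomial (Fin 3 → ι) ℝ}
    (hQ : Q.IsHomogeneous d) :
    ∃ p : (Fin d × Fin 3 → ι) → ℝ, ∀ D, MvPolynomial.eval D Q = p ⬝ᵥ tensorMonomial d D := by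
  obtain ⟨p, hp⟩ := exists_tensor_of_isHomogeneous hQ
  refine ⟨fun i => p (Function.curry i), fun D => ?_⟩
  rw [hp]
  exact Fintype.sum_equiv (Equiv.curry _ _ _).symm _ _ fun k => rfl

end TensorMonomial

theorem exists_orthonormalBasis_of_orthonormal {n : ℕ} {F : Type*} [NormedAddCommGroup F]
    [InnerProductSpace ℝ F] [FiniteDimensional ℝ F] (hn : Module.finrank ℝ F = n)
    {v : Fin n → F} (hv : Orthonormal ℝ v) : ∃ b : OrthonormalBasis (Fin n) ℝ F, ∀ i, b i = v i := by
  let b := basisOfLinearIndependentOfCardEqFinrank' v hv.linearIndependent (by simp [hn])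
  have hb : ⇑b = v := coe_basisOfLinearIndependentOfCardEqFinrank' _ _ _
  refine ⟨b.toOrthonormalBasis (by rw [hb]; exact hv), fun i => ?_⟩
  rw [Module.Basis.coe_toOrthonormalBasis, hb]

namespace JMap
open Matrix
variable {m r : ℕ} (j : JMap m r)

theorem exists_orthonormalBasis_rotate {n : ℕ} (b : OrthonormalBasis (Fin n) ℝ j.NilGroup)
    {A : Matrix (Fin n) (Fin n) ℝ} (hA : A * Aᵀ = 1) :
    ∃ b' : OrthonormalBasis (Fin n) ℝ j.NilGroup, ∀ i, b' i = ∑ k, A i k • b k := by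
  refine exists_orthonormalBasis_of_orthonormal (by
    rw [Module.finrank_eq_card_basis b.toBasis, Fintype.card_fin]) ?_
  rw [orthonormal_iff_ite]
  intro i k
  have h := congrFun (congrFun hA i) k
  rw [mul_apply, one_apply] at h
  rw [← h]
  simp [sum_inner, inner_sum, inner_smul_left, inner_smul_right,
    orthonormal_iff_ite.mp b.orthonormal, mul_comm]

theorem structureConst_rotate {n : ℕ} {b b' : OrthonormalBasis (Fin n) ℝ j.NilGroup}
    {A : Matrix (Fin n) (Fin n) ℝ} (h : ∀ i, b' i = ∑ k, A i k • b k) :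
    j.structureConst b' = tensorPower (Fin 3) A *ᵥ j.structureConst b := by
  funext v
  simp only [structureConst, h, MultilinearMap.map_sum, MultilinearMap.map_smul_univ, mulVec,
    dotProduct, tensorPower, of_apply, smul_eq_mul]

theorem evalAt_eq {n : ℕ} (P : MvPolynomial (CurvatureVar n) ℝ) {x : j.NilGroup}
    {e : Module.Basis (Fin n) ℝ j.NilGroup} {b : OrthonormalBasis (Fin n) ℝ j.NilGroup}
    (hb : ∀ i, b i = j.leftDifferential x (e i)) :
    j.metric.evalAt P x e = MvPolynomial.eval (j.structureConst b) (structureConstPoly P) := by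
  rw [SmoothMetric.evalAt, structureConstPoly, ← MvPolynomial.aeval_eq_eval,
    ← MvPolynomial.aeval_eq_eval, MvPolynomial.aeval_bind₁]
  congr 2
  funext s
  refine (j.nablaCurvature_eq _ _ _).trans (Eq.trans ?_ (j.eval_nablaCurvaturePoly b _ _).symm)
  simp only [hb]

theorem isOrthonormalAt_zero {n : ℕ} (b : OrthonormalBasis (Fin n) ℝ j.NilGroup) :
    j.metric.IsOrthonormalAt 0 b.toBasis := by
  intro i k
  rw [metric_val, leftDifferential_zero, leftDifferential_zero]
  exact orthonormal_iff_ite.mp b.orthonormal i k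

theorem exists_orthonormalBasis_of_isOrthonormalAt {n : ℕ} {x : j.NilGroup}
    {e : Module.Basis (Fin n) ℝ j.NilGroup} (he : j.metric.IsOrthonormalAt x e) :
    ∃ b : OrthonormalBasis (Fin n) ℝ j.NilGroup, ∀ i, b i = j.leftDifferential x (e i) :=
  exists_orthonormalBasis_of_orthonormal
    (by rw [Module.finrank_eq_card_basis e, Fintype.card_fin])
    (orthonormal_iff_ite.mpr fun i k => he i k)

/-- At the identity the left differential is trivial, so every orthonormal basis of the Lie algebra
is admissible in the definition of a curvature invariant. -/
theorem eval_structureConstPoly_eq {n : ℕ} {P : MvPolynomial (CurvatureVar n) ℝ}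
    (hP : IsCurvatureInvariant P) (b b' : OrthonormalBasis (Fin n) ℝ j.NilGroup) :
    MvPolynomial.eval (j.structureConst b) (structureConstPoly P) =
      MvPolynomial.eval (j.structureConst b') (structureConstPoly P) := by
  rw [← j.evalAt_eq P (x := 0) (e := b.toBasis) (b := b) fun i => by simp [leftDifferential_zero],
    ← j.evalAt_eq P (x := 0) (e := b'.toBasis) (b := b') fun i => by simp [leftDifferential_zero]]
  exact hP _ _ _ _ _ (j.isOrthonormalAt_zero b) (j.isOrthonormalAt_zero b')

/-- A curvature invariant of the manifolds `G(j)` is a complete contraction of a tensor power of the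
structure constants. -/
theorem exists_pairingSpan_evalAt_eq {n d : ℕ} {P : MvPolynomial (CurvatureVar n) ℝ}
    (hP : IsCurvatureInvariant P) (hord : HasOrder P d) :
    ∃ w ∈ pairingSpan (Fin n) (Finset.univ : Finset (Fin d × Fin 3)),
      ∀ (m r : ℕ) (j : JMap m r) (x : j.NilGroup) (e : Module.Basis (Fin n) ℝ j.NilGroup)
        (b : OrthonormalBasis (Fin n) ℝ j.NilGroup), j.metric.IsOrthonormalAt x e →
        j.metric.evalAt P x e = w ⬝ᵥ tensorMonomial d (j.structureConst b) := by
  have hQ : (structureConstPoly P).IsHomogeneous d :=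
    isHomogeneous_bind₁_of_isWeightedHomogeneous hord
      fun s => isHomogeneous_nablaCurvaturePoly s.1 s.2
  obtain ⟨p, hp⟩ := exists_tensorMonomial_dotProduct hQ
  -- The set contains the structure constants of all `𝔤(j)` of dimension `n`, which makes `w`
  -- uniform in `m`, `r` and `j`. Rotating the orthonormal basis shows that it is stable.
  obtain ⟨w, hwI, hw⟩ := exists_orthogonalInvariant_dotProduct_eq
    {u | ∃ (m r : ℕ) (j : JMap m r) (b : OrthonormalBasis (Fin n) ℝ j.NilGroup),
      u = tensorMonomial d (j.structureConst b)} p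
    (by
      rintro A hA _ ⟨m, r, j, b, rfl⟩
      obtain ⟨b', hb'⟩ := j.exists_orthonormalBasis_rotate b hA
      exact ⟨m, r, j, b', by rw [tensorPower_mulVec_tensorMonomial, j.structureConst_rotate hb']⟩)
    (by
      rintro A hA _ ⟨m, r, j, b, rfl⟩
      obtain ⟨b', hb'⟩ := j.exists_orthonormalBasis_rotate b hA
      rw [tensorPower_mulVec_tensorMonomial, ← j.structureConst_rotate hb', ← hp, ← hp]
      exact j.eval_structureConstPoly_eq hP b' b)
  refine ⟨w, by rwa [← orthogonalInvariants_eq_pairingSpan], fun m r j x e b he => ?_⟩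
  obtain ⟨b₀, hb₀⟩ := j.exists_orthonormalBasis_of_isOrthonormalAt he
  rw [j.evalAt_eq P hb₀, j.eval_structureConstPoly_eq hP b₀ b, hp]
  exact (hw _ ⟨m, r, j, b, rfl⟩).symm

end JMap

/-! ### Contractions of the structure constants as trace invariants -/

theorem splitWrtComposition_eq_of_flatten {α : Type*} {n : ℕ} {l : List α} {L : List (List α)}
    (hl : l = L.flatten) (c : Composition n) (hc : L.map List.length = c.blocks) :
    l.splitWrtComposition c = L := by
  have hn : L.flatten.length = n := by rw [List.length_flatten, hc, c.blocks_sum]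
  subst hn hl
  exact List.splitWrtComposition_flatten L c hc

theorem ofFn_get_cast {α β : Type*} {n : ℕ} {l : List α} (h : l.length = n) (f : α → β) :
    List.ofFn (fun i : Fin n => f (l.get (i.cast h.symm))) = l.map f := by
  subst h
  conv_rhs => rw [← List.ofFn_get l, List.map_ofFn]
  rfl

namespace JMap
open Matrix
variable {m r : ℕ} (j : JMap m r)

/-- The standard orthonormal basis of `𝔤(j)`. -/
def stdBasis : OrthonormalBasis (Fin m ⊕ Fin r) ℝ j.NilGroup :=
  (OrthonormalBasis.prod (EuclideanSpace.basisFun (Fin m) ℝ) (EuclideanSpace.basisFun (Fin r) ℝ) :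
    OrthonormalBasis (Fin m ⊕ Fin r) ℝ (Space m r))

theorem stdBasis_inl (a : Fin m) :
    j.stdBasis (Sum.inl a) = (WithLp.toLp 2 (EuclideanSpace.single a 1, 0) : Space m r) := by
  refine (OrthonormalBasis.prod_apply _ _ _).trans ?_
  simp

theorem stdBasis_inr (α : Fin r) :
    j.stdBasis (Sum.inr α) = (WithLp.toLp 2 (0, EuclideanSpace.single α 1) : Space m r) := by
  refine (OrthonormalBasis.prod_apply _ _ _).trans ?_
  simp

/-- The matrix of `j_{Z_α}` in the standard basis. -/
def basisMatrix (α : Fin r) : Matrix (Fin m) (Fin m) ℝ :=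
  LinearMap.toMatrixOrthonormal (EuclideanSpace.basisFun (Fin m) ℝ) (j.basisEnd α)

theorem basisMatrix_apply (α : Fin r) (a b : Fin m) :
    j.basisMatrix α a b =
      ⟪j.basisEnd α (EuclideanSpace.single b 1), EuclideanSpace.single a 1⟫ := by
  rw [basisMatrix, LinearMap.toMatrixOrthonormal_apply_apply, real_inner_comm]
  simp

theorem basisMatrix_transpose (α : Fin r) : (j.basisMatrix α)ᵀ = -j.basisMatrix α := by
  ext a b
  rw [transpose_apply, neg_apply, basisMatrix_apply, basisMatrix_apply]
  exact j.skew _ _ _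

theorem trace_prod_basisEnd {τ : Type*} (f : τ → Fin r) (w : List τ) :
    LinearMap.trace ℝ (EuclideanSpace ℝ (Fin m)) (w.map fun t => j.basisEnd (f t)).prod =
      ((w.map fun t => j.basisMatrix (f t)).prod).trace := by
  rw [LinearMap.trace_eq_matrix_trace ℝ (EuclideanSpace.basisFun (Fin m) ℝ).toBasis]
  change (LinearMap.toMatrixOrthonormal (EuclideanSpace.basisFun (Fin m) ℝ) _).trace = _
  rw [map_list_prod, List.map_map]
  rfl

theorem structureConst_stdBasis (v : Fin 3 → Fin m ⊕ Fin r) :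
    j.structureConst j.stdBasis v =
      ⟪j.bracketV (j.stdBasis (v 0) : Space m r).fst (j.stdBasis (v 1) : Space m r).fst,
        (j.stdBasis (v 2) : Space m r).snd⟫ := by
  have h : ∀ a b c : Space m r, ⟪j.bracket a b, c⟫ = ⟪j.bracketV a.fst b.fst, c.snd⟫ := by
    intro a b c
    rw [bracket_apply, WithLp.prod_inner_apply]
    simp
  exact h _ _ _

theorem structureConst_inl_inl_inr {v : Fin 3 → Fin m ⊕ Fin r} {a b : Fin m} {α : Fin r}
    (h₀ : v 0 = Sum.inl a) (h₁ : v 1 = Sum.inl b) (h₂ : v 2 = Sum.inr α) :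
    j.structureConst j.stdBasis v = j.basisMatrix α b a := by
  rw [structureConst_stdBasis, h₀, h₁, h₂, stdBasis_inl, stdBasis_inl, stdBasis_inr,
    basisMatrix_apply, real_inner_comm]
  exact (j.inner_bracketV _ _ _).symm

theorem structureConst_eq_zero {v : Fin 3 → Fin m ⊕ Fin r}
    (h : (v 0).isRight ∨ (v 1).isRight ∨ (v 2).isLeft) : j.structureConst j.stdBasis v = 0 := by
  rw [structureConst_stdBasis]
  rcases h with h | h | h
  · obtain ⟨α, h⟩ := Sum.isRight_iff.mp h
    rw [h, stdBasis_inr]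
    simp
  · obtain ⟨α, h⟩ := Sum.isRight_iff.mp h
    rw [h, stdBasis_inr]
    simp
  · obtain ⟨α, h⟩ := Sum.isLeft_iff.mp h
    rw [h, stdBasis_inl]
    simp

theorem exists_traceIndex {q : ℕ} {k : Fin (2 * q) → Fin q}
    (hk : ∀ i, (Finset.univ.filter fun s => k s = i).card = 2) {L : List (List (Fin (2 * q)))}
    (hL : ∀ w ∈ L, w ≠ []) (hm : (L.flatten : Multiset (Fin (2 * q))) = Finset.univ.val) :
    ∃ I : TraceIndex q, ∀ (m r : ℕ) (j : JMap m r), j.traceInvariant I.1.1 I.2 =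
      ∑ α : Fin q → Fin r,
        (L.map fun w => ((w.map fun t => j.basisMatrix (α (k t))).prod).trace).prod := by
  have hlen : L.flatten.length = 2 * q := by
    rw [← Multiset.coe_card, hm]; simp
  have hnd : L.flatten.Nodup := by
    rw [← Multiset.coe_nodup, hm]; exact Finset.univ.nodup
  -- Reading the words of `L` one after another visits each position once. The tuple sought is `k`
  -- permuted in this way, with bars between the words.
  let σ : Fin (2 * q) → Fin (2 * q) := fun i => L.flatten.get (i.cast hlen.symm)
  have hσ : Function.Bijective σ := by
    refine Finite.injective_iff_bijective.mp fun a b hab => ?_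
    exact Fin.cast_injective _ (List.nodup_iff_injective_get.mp hnd hab)
  have hofFn : ∀ {β : Type} (f : Fin (2 * q) → β),
      List.ofFn (fun i => f (σ i)) = (L.map (List.map f)).flatten := by
    intro β f
    rw [← List.map_flatten]
    exact ofFn_get_cast hlen f
  let c : Composition (2 * q) :=
    { blocks := L.map List.length
      blocks_pos := fun {i} hi => by
        obtain ⟨w, hw, rfl⟩ := List.mem_map.mp hi
        exact List.length_pos_iff.mpr (hL w hw)
      blocks_sum := by rw [← List.length_flatten, hlen] }
  refine ⟨⟨⟨k ∘ σ, fun i => ?_⟩, c⟩, fun m r j => ?_⟩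
  · refine Eq.trans ?_ (hk i)
    exact Finset.card_bijective σ hσ fun s => by simp
  · refine Finset.sum_congr rfl fun α _ => ?_
    have hsplit : (List.ofFn fun i => j.basisEnd (α (k (σ i)))).splitWrtComposition c =
        L.map (List.map fun t => j.basisEnd (α (k t))) :=
      splitWrtComposition_eq_of_flatten (hofFn fun t => j.basisEnd (α (k t))) c (by simp [c, Function.comp_def])
    change (List.map _ (List.splitWrtComposition
      (List.ofFn fun i => j.basisEnd (α (k (σ i)))) c)).prod = _
    rw [hsplit]
    rw [List.map_map]
    congr 2
    funext w
    exact j.trace_prod_basisEnd (fun t => α (k t)) w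

/-- The contraction of the structure constants according to a pairing of the index slots is a
linear combination of trace invariants. -/
theorem exists_contraction_eq {q : ℕ} {E : Type} [Fintype E] [DecidableEq E]
    {π : Fin (2 * q) × Fin 3 → E} (hπ : IsPairingOn Finset.univ π) (hs : Function.Surjective π) :
    ∃ c : TraceIndex q → ℝ, ∀ (m r : ℕ) (j : JMap m r),
      ∑ a : E → Fin m ⊕ Fin r, tensorMonomial (2 * q) (j.structureConst j.stdBasis) (a ∘ π) =
        ∑ I : TraceIndex q, c I * j.traceInvariant I.1.1 I.2 := by
  classical
  -- If a third slot is paired with a first or second one, the common index would have to lie in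
  -- both `𝔷` and `𝔳`, so every term vanishes.
  by_cases hmix : ∃ t t', π (t, 0) = π (t', 2) ∨ π (t, 1) = π (t', 2)
  · refine ⟨0, fun m r j => ?_⟩
    simp only [Pi.zero_apply, zero_mul, Finset.sum_const_zero]
    refine Finset.sum_eq_zero fun a _ => ?_
    obtain ⟨t, t', h⟩ := hmix
    rcases hc : a (π (t', 2)) with x | α
    · refine Finset.prod_eq_zero (Finset.mem_univ t') (j.structureConst_eq_zero ?_)
      simp [hc]
    · refine Finset.prod_eq_zero (Finset.mem_univ t) (j.structureConst_eq_zero ?_)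
      rcases h with h | h <;> simp [h, hc]
  · push Not at hmix
    let Z : E → Prop := fun e => ∃ t, π (t, 2) = e
    have hZ₀ : ∀ t, ¬ Z (π (t, 0)) := fun t ⟨t', h⟩ => (hmix t t').1 h.symm
    have hZ₁ : ∀ t, ¬ Z (π (t, 1)) := fun t ⟨t', h⟩ => (hmix t t').2 h.symm
    have hdeg : ∀ e, ((∑ t, if π (t, 0) = e then 1 else 0) + ∑ t, if π (t, 1) = e then 1 else 0)
        + (∑ t, if π (t, 2) = e then 1 else 0) = 2 := by
      intro e
      obtain ⟨s, rfl⟩ := hs e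
      refine Eq.trans ?_ (hπ s (Finset.mem_univ s))
      rw [Finset.card_filter, Fintype.sum_prod_type]
      simp only [Fin.sum_univ_three, Finset.sum_add_distrib]
    let z : Fin (2 * q) → {e // Z e} := fun t => ⟨π (t, 2), t, rfl⟩
    -- Slots `1` and `0` are rows and columns in this order, because `⟨[X_a, X_b], Z_α⟩` is the
    -- entry `(b, a)` of `j_{Z_α}`.
    let s₀ : Fin (2 * q) → {e // ¬ Z e} := fun t => ⟨π (t, 1), hZ₁ t⟩
    let s₁ : Fin (2 * q) → {e // ¬ Z e} := fun t => ⟨π (t, 0), hZ₀ t⟩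
    have hz : ∀ e, (Finset.univ.filter fun t => z t = e).card = 2 := by
      rintro ⟨e, he⟩
      have h := hdeg e
      rw [Finset.sum_eq_zero fun t _ => if_neg fun (h : π (t, 0) = e) => hZ₀ t (h ▸ he),
        Finset.sum_eq_zero fun t _ => if_neg fun (h : π (t, 1) = e) => hZ₁ t (h ▸ he),
        zero_add, zero_add] at h
      refine Eq.trans ?_ h
      rw [Finset.card_filter]
      simp only [z, Subtype.mk.injEq]
    have hcard : Fintype.card {e // Z e} = q := by
      have h := Finset.card_eq_sum_card_fiberwise (s := Finset.univ) (t := Finset.univ) (f := z)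
        (fun _ _ => Finset.mem_coe.mpr (Finset.mem_univ _))
      simp only [hz, Finset.sum_const, Finset.card_univ, Fintype.card_fin, smul_eq_mul] at h
      omega
    let φ : {e // Z e} ≃ Fin q := Fintype.equivFinOfCardEq hcard
    -- The letters are the positions `t` themselves, one per edge; the matrix attached to `t` is
    -- chosen only once `α` is given. Thus `ε` and `L` depend on the pairing alone.
    obtain ⟨ε, L, hL, hm, hprod⟩ := isTraceProduct_of_labelDegree _ _ _ rfl s₀ s₁
      (fun t => [t]) (by simp) (by
        rintro ⟨e, he⟩
        have h := hdeg e
        rw [Finset.sum_eq_zero (f := fun t => if π (t, 2) = e then 1 else 0)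
          fun t _ => if_neg fun h => he ⟨t, h⟩] at h
        simp only [labelDegree, s₀, s₁, Subtype.mk.injEq]
        omega)
    obtain ⟨I, hI⟩ := exists_traceIndex (k := fun t => φ (z t)) (fun i => by
      refine Eq.trans ?_ (hz (φ.symm i))
      congr 1
      ext t
      simp [Equiv.eq_symm_apply]) hL (by
        rw [hm]
        simp only [Multiset.coe_singleton]
        exact Finset.sum_multiset_singleton _)
    refine ⟨fun I' => if I' = I then ε else 0, fun m r j => ?_⟩
    simp only [ite_mul, zero_mul, Finset.sum_ite_eq', Finset.mem_univ, if_true]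
    rw [hI m r j, Finset.mul_sum]
    have hα : ∀ α : Fin q → Fin r,
        ε * (L.map fun w => ((w.map fun t => j.basisMatrix (α (φ (z t)))).prod).trace).prod =
          ∑ x : {e // ¬ Z e} → Fin m, ∏ t, j.basisMatrix (α (φ (z t))) (x (s₀ t)) (x (s₁ t)) := by
      intro α
      rw [← hprod (Fin m) (fun t => j.basisMatrix (α (φ (z t))))
        fun t => j.basisMatrix_transpose _]
      simp
    simp only [hα]
    rw [← Fintype.sum_prod_type' (f := fun (α : Fin q → Fin r) (x : {e // ¬ Z e} → Fin m) =>
      ∏ t, j.basisMatrix (α (φ (z t))) (x (s₀ t)) (x (s₁ t)))]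
    symm
    -- A pair consisting of `α` and `𝔳`-indices is a labelling that respects the types of the slots;
    -- labellings outside the image contribute zero.
    refine Fintype.sum_of_injective (fun (p : (Fin q → Fin r) × ({e // ¬ Z e} → Fin m)) e =>
      if he : Z e then Sum.inr (p.1 (φ ⟨e, he⟩)) else Sum.inl (p.2 ⟨e, he⟩)) ?_ _ _ ?_ ?_
    · rintro ⟨α, x⟩ ⟨α', x'⟩ h
      refine Prod.ext (funext fun i => ?_) (funext fun e => ?_)
      · have h2 := congrFun h (φ.symm i).1
        simpa [(φ.symm i).2] using h2
      · have h2 := congrFun h e.1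
        simpa [e.2] using h2
    · intro a ha
      by_contra hne
      refine ha ?_
      have hr : ∀ e, Z e → (a e).isRight := by
        rintro _ ⟨t, rfl⟩
        by_contra hc
        refine hne (Finset.prod_eq_zero (Finset.mem_univ t) (j.structureConst_eq_zero ?_))
        simpa using Or.inr (Or.inr hc)
      have hl : ∀ e, ¬ Z e → (a e).isLeft := by
        intro e he
        by_contra hc
        obtain ⟨⟨t, s⟩, rfl⟩ := hs e
        refine hne (Finset.prod_eq_zero (Finset.mem_univ t) (j.structureConst_eq_zero ?_))
        fin_cases s
        · exact Or.inl (by simpa using hc)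
        · exact Or.inr (Or.inl (by simpa using hc))
        · exact absurd ⟨t, rfl⟩ he
      refine ⟨⟨fun i => (a (φ.symm i).1).getRight (hr _ (φ.symm i).2),
        fun e => (a e.1).getLeft (hl _ e.2)⟩, funext fun e => ?_⟩
      by_cases he : Z e <;> simp [he]
    · rintro ⟨α, x⟩
      refine Finset.prod_congr rfl fun t _ => ?_
      refine (j.structureConst_inl_inl_inr ?_ ?_ ?_).symm
      · simp only [Function.comp_apply, hZ₀ t, dif_neg, not_false_eq_true]; rfl
      · simp only [Function.comp_apply, hZ₁ t, dif_neg, not_false_eq_true]; rfl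
      · exact dif_pos (⟨t, rfl⟩ : Z (π (t, 2)))

theorem exists_coeff_of_mem_pairingSpan {n q : ℕ} {w : (Fin (2 * q) × Fin 3 → Fin n) → ℝ}
    (hw : w ∈ pairingSpan (Fin n) (Finset.univ : Finset (Fin (2 * q) × Fin 3))) :
    ∃ c : TraceIndex q → ℝ, ∀ (m r : ℕ) (h : m + r = n) (j : JMap m r),
      w ⬝ᵥ tensorMonomial (2 * q)
        (j.structureConst (j.stdBasis.reindex (finSumFinEquiv.trans (finCongr h)))) =
      ∑ I : TraceIndex q, c I * j.traceInvariant I.1.1 I.2 := by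
  rw [pairingSpan_univ_eq] at hw
  induction hw using Submodule.span_induction with
  | mem w hw =>
    obtain ⟨E, _, _, π, hπ, hs, rfl⟩ := hw
    obtain ⟨c, hc⟩ := exists_contraction_eq hπ hs
    refine ⟨c, fun m r h j => ?_⟩
    rw [← hc m r j]
    refine (sum_pairingTensor_mul hs _).trans ?_
    refine Fintype.sum_equiv ((Equiv.refl E).arrowCongr (finSumFinEquiv.trans (finCongr h)).symm)
      _ _ fun a => ?_
    refine Finset.prod_congr rfl fun t _ => ?_
    simp [structureConst]
  | zero => exact ⟨0, fun m r h j => by simp⟩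
  | add u v _ _ hu hv =>
    obtain ⟨c, hc⟩ := hu
    obtain ⟨d, hd⟩ := hv
    exact ⟨c + d, fun m r h j => by
      simp [add_dotProduct, hc m r h j, hd m r h j, add_mul, Finset.sum_add_distrib]⟩
  | smul k u _ hu =>
    obtain ⟨c, hc⟩ := hu
    exact ⟨k • c, fun m r h j => by
      simp [smul_dotProduct, hc m r h j, mul_assoc, Finset.mul_sum]⟩

end JMap

end

theorem mainTheorem6 (n q : ℕ) (hq : 1 ≤ q) (P : MvPolynomial (CurvatureVar n) ℝ)
    (hP : IsCurvatureInvariant P) (hord : HasOrder P (2 * q)) :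
    ∃ c : TraceIndex q → ℝ, ∀ (m r : ℕ), m + r = n → ∀ (j : JMap m r) (x : j.NilGroup)
      (e : Module.Basis (Fin n) ℝ j.NilGroup), j.metric.IsOrthonormalAt x e →
        j.metric.evalAt P x e = ∑ I : TraceIndex q, c I * j.traceInvariant I.1.1 I.2 := by
  obtain ⟨w, hw, hval⟩ := JMap.exists_pairingSpan_evalAt_eq hP hord
  obtain ⟨c, hc⟩ := JMap.exists_coeff_of_mem_pairingSpan hw
  -- The basis left open is the standard one, reindexed by `Fin n`.
  exact ⟨c, fun m r h j x e he => (hval m r j x e _ he).trans (hc m r h j)⟩
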